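/- Let $n\ge 1$, let $d\gamma_{-1}(x)=\pi^{n/2}e^{|x|^2}\,dx$ on $\mathbb{R}^n$, and for $t>0$ let $$h_t(x,y)=\frac{e^{-nt}}{\pi^n(1-e^{-2t})^{n/2}}\exp\Big(-\frac{|x+y|^2}{2(1+e^{-t})}-\frac{|x-y|^2}{2(1-e^{-t})}\Big),\qquad H_t(x,y)=h_t(x,y)\,\pi^{n/2}e^{|y|^2},$$ be the Mehler kernels, with respect to $\gamma_{-1}$ and to Lebesgue measure respectively, of the semigroup $e^{-t\mathcal A}$ generated by $-\mathcal A=\frac12\Delta+x\cdot\nabla$. Put $H^*(x,y)=\sup_{t>0}H_t(x,y)\in[0,\infty]$. For $\delta>0$ let $N_\delta=\{(x,y)\in\mathbb{R}^n\times\mathbb{R}^n:|x-y|\le\delta/(1+|x|+|y|)\}$, and let $G$ be the complement of $N_1$. With $\alpha=|x-y||x+y|$ and $\beta=|x-y|/|x+y|$, let $\Phi(x,y)=\alpha^{-n/2}$ if $\beta\ge1$, $\Phi(x,y)=\alpha^{-n/2}+(1-\beta)^n$ if $\beta<1$, and $$\bar K(x,y)=e^{-|x|^2+|y|^2}\Big(\frac{|x+y|}{|x-y|}\Big)^{n/2}e^{\frac{|x|^2}{2}-\frac{|y|^2}{2}-\frac{|x-y||x+y|}{2}}\,\Phi(x,y)\,\chi_G(x,y),$$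 where at $x=-y$ (where $\beta=\infty$) the product $(|x+y|/|x-y|)^{n/2}\Phi(x,y)$ is read as $|x-y|^{-n}$, the value of this product wherever $1\le\beta<\infty$. A map $T$ on $L^1(\gamma_{-1})$ (complex-valued functions) is of weak type $(1,1)$ with constant $C$ if, for every $f\in L^1(\gamma_{-1})$, $|Tf|$ is measurable and $\gamma_{-1}\{|Tf|>s\}\le C\|f\|_{L^1(\gamma_{-1})}/s$ for every $s>0$. Then there is a constant $C$, depending only on $n$, such that the following hold. 1. $H^*(x,y)\le C\,\bar K(x,y)$ for every $(x,y)\in G$. 2. For every $f\in L^1(\gamma_{-1})$ and every $x\in\mathbb{R}^n$ the integral $\bar{\mathcal K}f(x)=\int_{\mathbb{R}^n}\bar K(x,y)f(y)\,dy$ converges absolutely, and $\bar{\mathcal K}$ is of weak type $(1,1)$ with constant $C$. 3. Let $\chi:\mathbb{R}^n\times\mathbb{R}^n\to\mathbb{R}$ be any measurable function with $\chi_{N_1}\le\chi\le\chi_{N_2}$ (for instance a smooth one). Then the integrals $\int_{\mathbb{R}^n}(1-\chi(x,y))H_t(x,y)f(y)\,dy$ converge absolutely for all $f\in L^1(\gamma_{-1})$,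 $t>0$, $x\in\mathbb{R}^n$, and the global part of the Mehler maximal operator, $$f\mapsto\sup_{t>0}\Big|\int_{\mathbb{R}^n}(1-\chi(x,y))H_t(x,y)f(y)\,dy\Big|,$$ is of weak type $(1,1)$ with constant $C$. -/

import Mathlib

open MeasureTheory
open scoped ENNReal NNReal

namespace InverseGauss

noncomputable section

/-- The Euclidean space `ℝⁿ`. -/
abbrev E (n : ℕ) : Type := EuclideanSpace ℝ (Fin n)

/-- The density `γ₋₁(x) = π^{n/2} e^{|x|²}`. -/
def density {n : ℕ} (x : E n) : ℝ := Real.pi ^ ((n : ℝ) / 2) * Real.exp (‖x‖ ^ 2)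

/-- The inverse Gauss measure `dγ₋₁(x) = π^{n/2} e^{|x|²} dx` on `ℝⁿ`. -/
def gammaInv (n : ℕ) : Measure (E n) :=
  (volume : Measure (E n)).withDensity fun x => ENNReal.ofReal (density x)

/-- The Mehler kernel `h_t(x, y)` with respect to `γ₋₁`, that is, the integral kernel of the
semigroup `e^{-t𝒜}` (with `𝒜 = -½Δ - x·∇` on `L²(γ₋₁)`) with respect to `γ₋₁`. -/
def mehlerKernelGamma {n : ℕ} (t : ℝ) (x y : E n) : ℝ :=
  Real.exp (-(n * t)) / (Real.pi ^ n * (1 - Real.exp (-(2 * t))) ^ ((n : ℝ) / 2)) *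
    Real.exp (-(‖x + y‖ ^ 2 / (2 * (1 + Real.exp (-t))))
      - ‖x - y‖ ^ 2 / (2 * (1 - Real.exp (-t))))

/-- The Mehler kernel `H_t(x, y) = h_t(x, y) γ₋₁(y)` with respect to Lebesgue measure. -/
def mehlerKernel {n : ℕ} (t : ℝ) (x y : E n) : ℝ :=
  mehlerKernelGamma t x y * density y

/-- The maximal Mehler kernel `H^*(x, y) = sup_{t > 0} H_t(x, y)`, with values in `[0, ∞]`
(it is infinite on the diagonal when `n ≥ 1`). -/
def maximalMehlerKernel {n : ℕ} (x y : E n) : ℝ≥0∞ :=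
  ⨆ (t : ℝ) (_ : 0 < t), ENNReal.ofReal (mehlerKernel t x y)

/-- The regions `N_δ = {(x, y) : |x - y| ≤ δ / (1 + |x| + |y|)}`. -/
def localRegion (n : ℕ) (δ : ℝ) : Set (E n × E n) :=
  {p | ‖p.1 - p.2‖ ≤ δ / (1 + ‖p.1‖ + ‖p.2‖)}

/-- The global region `G`, the complement of `N₁`. -/
def globalRegion (n : ℕ) : Set (E n × E n) := (localRegion n 1)ᶜ

/-- `α = |x - y| |x + y|`. -/
def alpha {n : ℕ} (x y : E n) : ℝ := ‖x - y‖ * ‖x + y‖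

/-- `β = |x - y| / |x + y|` (used only for `x + y ≠ 0`). -/
def beta {n : ℕ} (x y : E n) : ℝ := ‖x - y‖ / ‖x + y‖

/-- `η(x, y) = e^{|x|²/2 - |y|²/2 - |x-y||x+y|/2}`. -/
def eta {n : ℕ} (x y : E n) : ℝ :=
  Real.exp (‖x‖ ^ 2 / 2 - ‖y‖ ^ 2 / 2 - ‖x - y‖ * ‖x + y‖ / 2)

open Classical in
/-- `Φ = α^{-n/2}` if `β ≥ 1` and `Φ = α^{-n/2} + (1 - β)^n` if `β < 1`
(used only for `x + y ≠ 0`). -/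
def Phi {n : ℕ} (x y : E n) : ℝ :=
  if 1 ≤ beta x y then 1 / alpha x y ^ ((n : ℝ) / 2)
  else 1 / alpha x y ^ ((n : ℝ) / 2) + (1 - beta x y) ^ n

open Classical in
/-- The product `(|x+y| / |x-y|)^{n/2} Φ(x, y)`. It equals `|x-y|^{-n}` wherever `β ≥ 1` and
`x + y ≠ 0`; at `x + y = 0`, where `β = ∞` and the product reads `0 · ∞`, it is given
this same value, which is its continuous extension. -/
def quotPhi {n : ℕ} (x y : E n) : ℝ :=
  if x + y = 0 then 1 / ‖x - y‖ ^ n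
  else (‖x + y‖ / ‖x - y‖) ^ ((n : ℝ) / 2) * Phi x y

/-- The kernel
`K̄(x, y) = e^{-|x|²+|y|²} (|x+y|/|x-y|)^{n/2} η(x, y) Φ(x, y) χ_G(x, y)`. -/
def barK {n : ℕ} (x y : E n) : ℝ :=
  (globalRegion n).indicator
    (fun p => Real.exp (-‖p.1‖ ^ 2 + ‖p.2‖ ^ 2) * eta p.1 p.2 * quotPhi p.1 p.2) (x, y)

/-- The integral operator with kernel `K̄` with respect to Lebesgue measure. -/
def barKOp {n : ℕ} (f : E n → ℂ) (x : E n) : ℂ :=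
  ∫ y, (barK x y : ℂ) * f y

/-- A cutoff between the indicator functions of the local regions `N₁` and `N₂`. -/
structure IsCutoff {n : ℕ} (χ : E n × E n → ℝ) : Prop where
  measurable : Measurable χ
  ge : ∀ p, (localRegion n 1).indicator (fun _ => (1 : ℝ)) p ≤ χ p
  le : ∀ p, χ p ≤ (localRegion n 2).indicator (fun _ => (1 : ℝ)) p

/-- The kernel `(1 - χ) H_t` of the global part of `e^{-t𝒜}`. -/
def mehlerKernelGlob {n : ℕ} (χ : E n × E n → ℝ) (t : ℝ) (x y : E n) : ℝ :=
  mehlerKernel t x y - χ (x, y) * mehlerKernel t x y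

/-- The global part of `e^{-t𝒜}`: the integral operator with kernel `(1 - χ) H_t`. -/
def mehlerGlob {n : ℕ} (χ : E n × E n → ℝ) (t : ℝ) (f : E n → ℂ) (x : E n) : ℂ :=
  ∫ y, (mehlerKernelGlob χ t x y : ℂ) * f y

/-- The global part of the Mehler maximal operator `ℋ^* f = sup_{t > 0} |e^{-t𝒜} f|`. -/
def maximalGlob {n : ℕ} (χ : E n × E n → ℝ) (f : E n → ℂ) (x : E n) : ℝ≥0∞ :=
  ⨆ (t : ℝ) (_ : 0 < t), ‖mehlerGlob χ t f x‖ₑ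

/-- For a map `T` sending a function `f` to (the modulus of) its image, with values in `[0, ∞]`:
`T` is of weak type `(1,1)` for `γ₋₁` with constant `C`, that is, for every `f ∈ L¹(γ₋₁)` the
function `T f` is measurable and `γ₋₁ {T f > s} ≤ C ‖f‖_{L¹(γ₋₁)} / s` for every `s > 0`. -/
def WeakType11With {n : ℕ} (T : (E n → ℂ) → E n → ℝ≥0∞) (C : ℝ≥0) : Prop :=
  ∀ f : E n → ℂ, Integrable f (gammaInv n) →
    AEMeasurable (T f) (gammaInv n) ∧
    ∀ s : ℝ, 0 < s →
      gammaInv n {x | ENNReal.ofReal s < T f x} ≤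
        C * (∫⁻ x, ‖f x‖ₑ ∂(gammaInv n)) / ENNReal.ofReal s

end

end InverseGauss

namespace InverseGauss

/-! Write D = |x - y|, S = |x + y| and u = tanh(t/2). Completing the square turns H_t, up to a
constant, into e^{-|x|² + |y|²} η ((1 - u)/√u)^n exp(-(D - uS)²/(4u)) (`mehlerKernel_eq`). The bound
on H^* is then a supremum in the single variable u ∈ (0, 1), computed in
`exists_mehler_le_quotProfile`.

For the weak type estimate let φ(ρ) = e^{ρ²} ρ^n / (1 + ρ²), whose derivative dominates half the
radial density e^{ρ²} ρ^{n-1} of the measure. The key bound (`exists_radial_le`,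
`exists_barK_le_angularKernel`) is φ(|x|) K̄(x, y) ≤ K a(x/|x|, y) e^{|y|²}, with an angular kernel
a that does not see |x|. Hence ∫ K̄(x, y)|f(y)| dy > s forces φ(|x|) ≤ A(x/|x|)/s, where A(ω) = K ∫
a(ω, y) e^{|y|²} |f(y)| dy. On each ray this set has weighted length at most 2A(ω)/s
(`setLIntegral_radial_le`). Integrating over the sphere and applying Tonelli leaves ∫ a(ω, y) dω,
which is bounded uniformly in y (`exists_lintegral_angularKernel_le`), and the L¹(γ₋₁) norm of f
remains.

The global Mehler kernels are dominated by K̄ uniformly in t, so the maximal operator inherits the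
estimate. Continuity in t makes the supremum measurable. -/

/-! ### Supremum over time, as a function of D and S. -/

lemma exists_pow_mul_exp_le (n : ℕ) {a b c : ℝ} (hc : 0 < c) :
    ∃ K : ℝ, 0 < K ∧ ∀ w : ℝ, 0 ≤ a * w + b →
      (a * w + b) ^ n * Real.exp (-(c * w ^ 2)) ≤ K := by
  refine ⟨n.factorial * Real.exp (b + a ^ 2 / (4 * c)), by positivity, fun w hw => ?_⟩
  have h1 : (a * w + b) ^ n ≤ n.factorial * Real.exp (a * w + b) := by
    have := Real.pow_div_factorial_le_exp (a * w + b) hw n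
    rwa [div_le_iff₀' (by positivity)] at this
  have h2 : a * w + b + -(c * w ^ 2) ≤ b + a ^ 2 / (4 * c) := by
    have : a * w - c * w ^ 2 ≤ a ^ 2 / (4 * c) := by
      rw [le_div_iff₀ (by positivity)]
      nlinarith [sq_nonneg (a - 2 * c * w)]
    linarith
  calc (a * w + b) ^ n * Real.exp (-(c * w ^ 2))
      ≤ n.factorial * Real.exp (a * w + b) * Real.exp (-(c * w ^ 2)) := by gcongr
    _ = n.factorial * Real.exp (a * w + b + -(c * w ^ 2)) := by rw [mul_assoc, ← Real.exp_add]
    _ ≤ _ := by gcongr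

/-- The product `(|x+y| / |x-y|)^{n/2} Φ` as a function of `D = |x - y|` and `S = |x + y|`. -/
noncomputable def quotProfile (n : ℕ) (D S : ℝ) : ℝ :=
  (1 / D) ^ n + (√(S / D) * max 0 (1 - D / S)) ^ n

lemma quotProfile_nonneg (n : ℕ) {D : ℝ} (hD : 0 ≤ D) (S : ℝ) : 0 ≤ quotProfile n D S := by
  unfold quotProfile; positivity

/-- The Gaussian peaks at u = D/S. If D ≥ S this lies outside (0, 1), and the term D^{-n} suffices.
If D < S, split 1 - u ≤ (1 - D/S) + |D/S - u|: the second summand is absorbed by the Gaussian, and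
the first produces the second term of the profile when u is not much smaller than D/S. -/
lemma exists_mehler_le_quotProfile (n : ℕ) :
    ∃ K : ℝ, 0 < K ∧ ∀ D S u : ℝ, 0 < D → 0 ≤ S → 0 < u → u < 1 →
      ((1 - u) / √u) ^ n * Real.exp (-((D - u * S) ^ 2 / (4 * u))) ≤ K * quotProfile n D S := by
  -- The weakest exponent below occurs for D/S > 4u, where D - uS ≥ 3D/4 gives (3/4)²/4 = 9/64 ≥
  -- 1/8.
  obtain ⟨K, hK, hKb⟩ := exists_pow_mul_exp_le n (a := 1) (b := 0) (c := 1 / 8) (by norm_num)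
  simp only [one_mul, add_zero] at hKb
  have key : ∀ p v d m : ℝ, 0 ≤ p → 0 ≤ v → 0 < d → p = v / d → v ^ 2 / 8 ≤ m →
      p ^ n * Real.exp (-m) ≤ K * (1 / d) ^ n := by
    intro p v d m hp hv hd hpv hm
    calc p ^ n * Real.exp (-m) ≤ p ^ n * Real.exp (-(1 / 8 * v ^ 2)) := by
          gcongr; linarith
      _ = (v ^ n * Real.exp (-(1 / 8 * v ^ 2))) * (1 / d) ^ n := by
          rw [hpv, div_pow, div_pow, one_pow]; ring
      _ ≤ _ := by gcongr; exact hKb v hv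
  refine ⟨2 ^ n * (2 ^ n + 2 * K), by positivity, fun D S u hD hS hu hu1 => ?_⟩
  have hsu : 0 < √u := Real.sqrt_pos.2 hu
  have hsq : √u ^ 2 = u := Real.sq_sqrt hu.le
  have h2n : (1 : ℝ) ≤ 2 ^ n := one_le_pow₀ (by norm_num)
  have hT1 : (1 / D) ^ n ≤ quotProfile n D S := by
    unfold quotProfile; simp only [le_add_iff_nonneg_right]; positivity
  have hT2 : (√(S / D) * max 0 (1 - D / S)) ^ n ≤ quotProfile n D S := by
    unfold quotProfile; simp only [le_add_iff_nonneg_left]; positivity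
  have hT0 := quotProfile_nonneg n hD.le S
  rcases le_or_gt S D with hSD | hSD
  · have h := key ((1 - u) / √u) ((1 - u) / √u * D) D ((D - u * S) ^ 2 / (4 * u))
      (div_nonneg (by linarith) hsu.le)
      (mul_nonneg (div_nonneg (by linarith) hsu.le) hD.le) hD (by field_simp) (by
        rw [mul_pow, div_pow, hsq, div_mul_eq_mul_div, div_div, div_le_div_iff₀ (by positivity)
          (by positivity)]
        have h1 : (1 - u) * D ≤ D - u * S := by nlinarith
        have h2 : ((1 - u) * D) ^ 2 ≤ (D - u * S) ^ 2 :=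
          pow_le_pow_left₀ (mul_nonneg (by linarith) hD.le) h1 2
        nlinarith [sq_nonneg (D - u * S)])
    refine h.trans ?_
    gcongr
    nlinarith
  · have hS0 : 0 < S := hD.trans hSD
    set b := D / S with hb
    have hb0 : 0 < b := by positivity
    have hb1 : b < 1 := (div_lt_one hS0).2 hSD
    have hDb : D = b * S := by rw [hb]; field_simp
    set p := (1 - b) / √u with hp
    set q := |b - u| / √u with hq
    have hp0 : 0 ≤ p := div_nonneg (by linarith) hsu.le
    have hq0 : 0 ≤ q := by positivity
    have hpq : (1 - u) / √u ≤ p + q := by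
      rw [hp, hq, ← add_div]; gcongr
      linarith [le_abs_self (b - u)]
    have hpow : ((1 - u) / √u) ^ n ≤ 2 ^ n * (p ^ n + q ^ n) := by
      calc ((1 - u) / √u) ^ n ≤ (p + q) ^ n :=
            pow_le_pow_left₀ (div_nonneg (by linarith) hsu.le) hpq n
        _ ≤ 2 ^ (n - 1) * (p ^ n + q ^ n) := add_pow_le hp0 hq0 n
        _ ≤ _ := by gcongr <;> [norm_num; omega]
    have hqb : q ^ n * Real.exp (-((D - u * S) ^ 2 / (4 * u))) ≤ K * quotProfile n D S := by
      have h := key q (q * S) S ((D - u * S) ^ 2 / (4 * u)) hq0 (by positivity) hS0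
        (by field_simp) (by
          rw [hq, mul_pow, div_pow, hsq, sq_abs, hDb, ← sub_mul, mul_pow,
            div_mul_eq_mul_div, div_div]
          exact div_le_div_of_nonneg_left (by positivity) (by positivity) (by linarith))
      refine h.trans (mul_le_mul_of_nonneg_left (le_trans ?_ hT1) hK.le)
      gcongr
    have hpb : p ^ n * Real.exp (-((D - u * S) ^ 2 / (4 * u))) ≤
        (2 ^ n + K) * quotProfile n D S := by
      rcases le_or_gt b (4 * u) with hbu | hbu
      · have hsb : √(S / D) = 1 / √b := by
          rw [← inv_div, Real.sqrt_inv, one_div]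
        have hmax : max 0 (1 - D / S) = 1 - b := max_eq_right (by linarith)
        have hsb0 : 0 < √b := Real.sqrt_pos.2 hb0
        have h1 : p ≤ 2 * (√(S / D) * max 0 (1 - D / S)) := by
          rw [hsb, hmax, hp]
          have : √b ≤ 2 * √u := by
            rw [show 2 * √u = √(4 * u) by
              rw [Real.sqrt_mul (by norm_num), show (4 : ℝ) = 2 ^ 2 by norm_num,
                Real.sqrt_sq (by norm_num)]]
            exact Real.sqrt_le_sqrt hbu
          rw [show 2 * (1 / √b * (1 - b)) = 2 * (1 - b) / √b by ring, div_le_div_iff₀ hsu hsb0]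
          nlinarith
        calc p ^ n * Real.exp (-((D - u * S) ^ 2 / (4 * u)))
            ≤ (2 * (√(S / D) * max 0 (1 - D / S))) ^ n * 1 := by
              gcongr
              rw [Real.exp_le_one_iff]
              simp only [Left.neg_nonpos_iff]; positivity
          _ = 2 ^ n * (√(S / D) * max 0 (1 - D / S)) ^ n := by rw [mul_pow, mul_one]
          _ ≤ 2 ^ n * quotProfile n D S := by gcongr
          _ ≤ _ := by gcongr; linarith
      · have h := key p (p * D) D ((D - u * S) ^ 2 / (4 * u)) hp0 (by positivity) hD
          (by field_simp) (by
            rw [hp, mul_pow, div_pow, hsq, div_mul_eq_mul_div, div_div, div_le_div_iff₀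
              (by positivity) (by positivity)]
            have h1 : 3 / 4 * D ≤ D - u * S := by rw [hDb]; nlinarith
            have h2 : (3 / 4 * D) ^ 2 ≤ (D - u * S) ^ 2 :=
              pow_le_pow_left₀ (by positivity) h1 2
            have h3 : (1 - b) ^ 2 * D ^ 2 ≤ 1 * D ^ 2 := by
              gcongr; nlinarith
            nlinarith [sq_nonneg D])
        refine h.trans ?_
        calc K * (1 / D) ^ n ≤ K * quotProfile n D S := by gcongr
          _ ≤ _ := by gcongr; linarith
    calc ((1 - u) / √u) ^ n * Real.exp (-((D - u * S) ^ 2 / (4 * u)))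
        ≤ 2 ^ n * (p ^ n + q ^ n) * Real.exp (-((D - u * S) ^ 2 / (4 * u))) := by gcongr
      _ = 2 ^ n * (p ^ n * Real.exp (-((D - u * S) ^ 2 / (4 * u))) +
            q ^ n * Real.exp (-((D - u * S) ^ 2 / (4 * u)))) := by ring
      _ ≤ 2 ^ n * ((2 ^ n + K) * quotProfile n D S + K * quotProfile n D S) := by gcongr
      _ = _ := by ring

/-! ### Radially weighted kernel and its angular majorant. -/

/-- For `|x| = ρ`, `|y| = r` and chordal angle `θ`, the decay of `η`. -/
lemma eta_decay {ρ r θ D S : ℝ} (hρ : 0 < ρ) (hr : 0 ≤ r) (hθ : 0 ≤ θ) (hθ2 : θ ≤ 2)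
    (hD : 0 < D) (hS : 0 ≤ S) (hD2 : D ^ 2 = (ρ - r) ^ 2 + ρ * r * θ ^ 2)
    (hS2 : S ^ 2 = (ρ + r) ^ 2 - ρ * r * θ ^ 2) :
    Real.exp (ρ ^ 2 / 2 - r ^ 2 / 2 - D * S / 2) ≤ 2 * (1 + ρ ^ 2) / (1 + r ^ 2) ∧
    (D < S → Real.exp (ρ ^ 2 / 2 - r ^ 2 / 2 - D * S / 2) ≤
      Real.exp (-(1 / 4 * (ρ * r * θ / √(D * S)) ^ 2)) * (4 * (1 + ρ ^ 2) / (1 + r ^ 2))) := by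
  have hDS2 : (D * S) ^ 2 = (ρ ^ 2 - r ^ 2) ^ 2 + ρ ^ 2 * r ^ 2 * θ ^ 2 * (4 - θ ^ 2) := by
    rw [mul_pow, hD2, hS2]; ring
  have hθ4 : 0 ≤ 4 - θ ^ 2 := by nlinarith
  have hDSabs : |ρ ^ 2 - r ^ 2| ≤ D * S := by
    apply abs_le_of_sq_le_sq _ (by positivity)
    rw [hDS2]; simp only [le_add_iff_nonneg_right]; positivity
  have hDS0 : 0 ≤ D * S := by positivity
  -- From e^{-z} ≤ 1/(1 + z) and DS ≥ |ρ² - r²|. The choice c = 1/2 uses all of η; c = 1/4 keeps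
  -- half of it for Gaussian decay in w.
  have hexp : ∀ c : ℝ, 1 / 4 ≤ c → c ≤ 1 / 2 →
      Real.exp (-(c * (D * S - (ρ ^ 2 - r ^ 2)))) ≤ (1 / c) * (1 + ρ ^ 2) / (1 + r ^ 2) := by
    intro c hc hc2
    have hx : 0 ≤ D * S - (ρ ^ 2 - r ^ 2) := by linarith [le_abs_self (ρ ^ 2 - r ^ 2)]
    have hx2 : r ^ 2 - ρ ^ 2 ≤ D * S - (ρ ^ 2 - r ^ 2) := by linarith
    rw [Real.exp_neg, inv_eq_one_div, div_le_div_iff₀ (Real.exp_pos _) (by positivity)]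
    have h1 := Real.add_one_le_exp (c * (D * S - (ρ ^ 2 - r ^ 2)))
    have h2 : 1 * (1 + r ^ 2) ≤ 1 / c * (1 + ρ ^ 2) * (c * (D * S - (ρ ^ 2 - r ^ 2)) + 1) := by
      have : 1 / c * (1 + ρ ^ 2) * (c * (D * S - (ρ ^ 2 - r ^ 2)) + 1) =
        (1 + ρ ^ 2) * ((D * S - (ρ ^ 2 - r ^ 2)) + 1 / c) := by field_simp
      rw [this]
      have h1c : 1 ≤ 1 / c := by rw [le_div_iff₀ (by linarith)]; linarith
      nlinarith [mul_nonneg (sq_nonneg ρ) hx]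
    refine h2.trans ?_
    have : 0 < c := by linarith
    gcongr
  constructor
  · convert hexp (1 / 2) (by norm_num) le_rfl using 2 <;> ring
  · intro hlt
    have hSpos : 0 < S := hD.trans hlt
    have hDSpos : 0 < D * S := mul_pos hD hSpos
    have hρr : 0 ≤ ρ * r := by positivity
    -- Factor (DS)² - (ρ² - r²)² as a difference of squares, with sum factor at most 2DS. The
    -- condition D < S gives ρrθ² ≤ 2ρr, so 4 - θ² may be replaced by 2.
    have hw : (ρ * r * θ / √(D * S)) ^ 2 ≤ D * S - (ρ ^ 2 - r ^ 2) := by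
      rw [div_pow, Real.sq_sqrt hDS0, div_le_iff₀ hDSpos]
      have hlt2 : D ^ 2 < S ^ 2 := by nlinarith
      have h3 : ρ * r * θ ^ 2 ≤ 2 * (ρ * r) := by nlinarith
      have h4 : (ρ * r * θ) ^ 2 * 2 ≤ ρ ^ 2 * r ^ 2 * θ ^ 2 * (4 - θ ^ 2) := by
        have : (ρ * r * θ ^ 2) * (ρ * r * θ ^ 2) ≤ 2 * (ρ * r) * (ρ * r * θ ^ 2) := by gcongr
        nlinarith
      have h5 := le_abs_self (ρ ^ 2 - r ^ 2)
      nlinarith [sq_nonneg (D * S - (ρ ^ 2 - r ^ 2))]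
    have h6 := hexp (1 / 4) le_rfl (by norm_num)
    calc Real.exp (ρ ^ 2 / 2 - r ^ 2 / 2 - D * S / 2)
        = Real.exp (-(1 / 4 * (D * S - (ρ ^ 2 - r ^ 2)))) *
          Real.exp (-(1 / 4 * (D * S - (ρ ^ 2 - r ^ 2)))) := by
          rw [← Real.exp_add]; congr 1; ring
      _ ≤ _ := by
          gcongr
          refine h6.trans (le_of_eq (by norm_num))

/-- The angle is controlled by the geometry of D alone. The cutoff 1/(1 + r²) needs the global
region when ρ ≤ 2r, where D > 1/(1 + 3r); when ρ > 2r, D ≥ ρ - r ≥ ρ/2 suffices. -/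
lemma mul_angle_le {ρ r θ D : ℝ} (hρ : 0 < ρ) (hr : 0 ≤ r) (hθ : 0 ≤ θ)
    (hD : 0 < D) (hD2 : D ^ 2 = (ρ - r) ^ 2 + ρ * r * θ ^ 2)
    (hθ2 : θ ≤ 2) (hG : 1 < D * (1 + ρ + r)) :
    ρ * max θ (1 / (1 + r ^ 2)) ≤ 7 * D := by
  have hr2 : 0 < 1 + r ^ 2 := by positivity
  have hρr : 0 ≤ ρ * r := by positivity
  have hDlow : ρ - r ≤ D := by
    refine le_of_abs_le (abs_le_of_sq_le_sq ?_ hD.le)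
    rw [hD2]; simp only [le_add_iff_nonneg_right]; positivity
  rw [mul_max_of_nonneg _ _ hρ.le]
  apply max_le
  · have : ρ * θ ≤ 2 * D := by
      refine le_of_abs_le (abs_le_of_sq_le_sq ?_ (by positivity))
      rw [mul_pow, mul_pow, hD2]
      have h4 : θ ^ 2 ≤ 4 := by nlinarith
      nlinarith [mul_nonneg (sub_nonneg.2 h4) (sq_nonneg (ρ - r)), sq_nonneg θ,
        mul_nonneg hρr (sq_nonneg θ), sq_nonneg (r * θ)]
    linarith
  · rw [mul_one_div, div_le_iff₀ hr2]
    rcases le_or_gt ρ (2 * r) with h | h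
    · have : 1 ≤ D * (1 + 3 * r) := hG.le.trans
        (mul_le_mul_of_nonneg_left (by linarith) hD.le)
      have h3 : ρ ≤ 2 * r * (D * (1 + 3 * r)) := by nlinarith
      have h4 : 2 * r * (1 + 3 * r) ≤ 7 * (1 + r ^ 2) := by nlinarith [sq_nonneg (r - 1)]
      nlinarith
    · nlinarith [mul_nonneg hD.le (sq_nonneg r)]

/-- For ρ ≤ 2r, the global region bounds S/D by 3r(1 + 3r). For ρ > 2r, S/D ≤ 3, and the smallness
of 1 - D/S turns the factor ρ into 4r. -/
lemma sqrt_mul_le {ρ r D S : ℝ} (hρ : 0 < ρ) (hr : 0 ≤ r) (hD : 0 < D) (hDlow : ρ - r ≤ D)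
    (hSup : S ≤ ρ + r) (hSD : D < S) (hbS : (1 - D / S) * S ^ 2 ≤ 4 * (ρ * r)) (hρS : ρ ≤ S)
    (hG : 1 < D * (1 + ρ + r)) :
    √(S / D) * (1 - D / S) * ρ ≤ 7 * (1 + r ^ 2) := by
  have hS0 : 0 < S := hD.trans hSD
  have hb : D / S < 1 := (div_lt_one hS0).2 hSD
  refine le_of_abs_le (abs_le_of_sq_le_sq ?_ (by positivity))
  rw [mul_pow, mul_pow, Real.sq_sqrt (by positivity), mul_pow]
  rcases le_or_gt ρ (2 * r) with h | h
  · have hS3 : S ≤ 3 * r := by linarith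
    have h3 : S / D ≤ 3 * r * (1 + 3 * r) := by
      rw [div_le_iff₀ hD]
      have : 1 ≤ D * (1 + 3 * r) := hG.le.trans
        (mul_le_mul_of_nonneg_left (by linarith) hD.le)
      nlinarith
    have h4 : (1 - D / S) ^ 2 ≤ 1 := by
      have : 0 < D / S := by positivity
      nlinarith
    calc S / D * (1 - D / S) ^ 2 * ρ ^ 2
        ≤ (3 * r * (1 + 3 * r)) * 1 * (2 * r) ^ 2 := by gcongr
      _ ≤ _ := by
            have : ∀ z : ℝ, 3 * z * (1 + 3 * z) * 1 * (2 * z) ^ 2 ≤ 7 ^ 2 * (1 + z ^ 2) ^ 2 := fun z => by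
              nlinarith [sq_nonneg (z * (z - 1)), sq_nonneg z, sq_nonneg (z ^ 2)]
            exact this r
  · have h3 : S / D ≤ 3 := by
      rw [div_le_iff₀ hD]; linarith
    have h4 : (1 - D / S) * ρ ≤ 4 * r := by
      have h5 : (1 - D / S) * ρ ^ 2 ≤ 4 * (ρ * r) := by
        refine le_trans ?_ hbS
        have : 0 ≤ 1 - D / S := by linarith
        gcongr
      have h6 : ρ * ((1 - D / S) * ρ) ≤ ρ * (4 * r) := by linarith
      exact le_of_mul_le_mul_left h6 hρ
    have h40 : 0 ≤ (1 - D / S) * ρ := mul_nonneg (by linarith) hρ.le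
    calc S / D * (1 - D / S) ^ 2 * ρ ^ 2 = S / D * ((1 - D / S) * ρ) ^ 2 := by ring
      _ ≤ 3 * (4 * r) ^ 2 := by gcongr
      _ ≤ _ := by
            have : ∀ z : ℝ, 3 * (4 * z) ^ 2 ≤ 7 ^ 2 * (1 + z ^ 2) ^ 2 := fun z => by
              nlinarith [sq_nonneg z, sq_nonneg (z ^ 2)]
            exact this r

/-- The two entries of the maximum are treated separately. The angle costs w = ρrθ/√(DS), unbounded
but later absorbed by the Gaussian of `eta_decay`; the cutoff costs the constant of `sqrt_mul_le`.
-/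
lemma sqrt_mul_angle_le {ρ r θ D S : ℝ} (hρ : 0 < ρ) (hr : 0 ≤ r) (hθ : 0 ≤ θ)
    (hD : 0 < D) (hD2 : D ^ 2 = (ρ - r) ^ 2 + ρ * r * θ ^ 2)
    (hS2 : S ^ 2 = (ρ + r) ^ 2 - ρ * r * θ ^ 2) (hSD : D < S) (hG : 1 < D * (1 + ρ + r)) :
    √(S / D) * (1 - D / S) * ρ * max θ (1 / (1 + r ^ 2)) ≤
      4 * (ρ * r * θ / √(D * S)) + 7 := by
  have hr2 : 0 < 1 + r ^ 2 := by positivity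
  have hS0 : 0 < S := hD.trans hSD
  have hS : 0 ≤ S := hS0.le
  have hρr : 0 ≤ ρ * r := by positivity
  have hDlow : ρ - r ≤ D := by
    refine le_of_abs_le (abs_le_of_sq_le_sq ?_ hD.le)
    rw [hD2]; simp only [le_add_iff_nonneg_right]; positivity
  have hDS2 : D ^ 2 + S ^ 2 = 2 * (ρ ^ 2 + r ^ 2) := by rw [hD2, hS2]; ring
  have hSup : S ≤ ρ + r := by
    refine le_of_abs_le (abs_le_of_sq_le_sq ?_ (by positivity))
    rw [hS2]; simp only [tsub_le_iff_right, le_add_iff_nonneg_right]; positivity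
  have hDS0 : 0 < D * S := by positivity
  set w := ρ * r * θ / √(D * S) with hw
  have hw0 : 0 ≤ w := by positivity
  have hb : D / S < 1 := (div_lt_one hS0).2 hSD
  have hSsq : ρ ^ 2 + r ^ 2 ≤ S ^ 2 := by nlinarith
  have hρS : ρ ≤ S := by
    refine le_of_abs_le (abs_le_of_sq_le_sq ?_ hS); nlinarith
  -- As D < S, the left side S² - DS is at most S² - D² = 4ρr - 2ρrθ².
  have hbS : (1 - D / S) * S ^ 2 ≤ 4 * (ρ * r) := by
    have : (1 - D / S) * S ^ 2 = S ^ 2 - D * S := by field_simp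
    rw [this]
    nlinarith [mul_nonneg hρr (sq_nonneg θ)]
  have hfirst := sqrt_mul_le hρ hr hD hDlow hSup hSD hbS hρS hG
  have hsecond : √(S / D) * (1 - D / S) * ρ * θ ≤ 4 * w := by
    have hsd : √(S / D) = S / √(D * S) := by
      rw [Real.sqrt_div hS, Real.sqrt_mul hD.le]
      have : 0 < √D := Real.sqrt_pos.2 hD
      have hsS : 0 < √S := Real.sqrt_pos.2 hS0
      field_simp
      exact Real.sq_sqrt hS
    rw [hsd, hw]
    have hq : 0 < √(D * S) := Real.sqrt_pos.2 hDS0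
    rw [show S / √(D * S) * (1 - D / S) * ρ * θ = (S * (1 - D / S) * ρ * θ) / √(D * S) by ring,
      ← mul_div_assoc]
    refine div_le_div_of_nonneg_right ?_ hq.le
    have h7 : (1 - D / S) * S * ρ ≤ 4 * (ρ * r) := by
      refine le_trans ?_ hbS
      have : 0 ≤ 1 - D / S := by linarith
      nlinarith [mul_nonneg (mul_nonneg this hS) (sub_nonneg.2 hρS)]
    have h8 := mul_le_mul_of_nonneg_right h7 hθ
    linarith
  have hQ0 : 0 ≤ √(S / D) * (1 - D / S) := mul_nonneg (by positivity) (by linarith)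
  rw [mul_max_of_nonneg _ _ (mul_nonneg hQ0 hρ.le)]
  apply max_le
  · linarith
  · rw [mul_one_div, div_le_iff₀ hr2]
    nlinarith [mul_nonneg hw0 hr2.le]

/-- The radial supremum of the weighted kernel is controlled by an angular kernel. -/
lemma exists_radial_le (n : ℕ) :
    ∃ K : ℝ, 0 < K ∧ ∀ ρ r θ D S : ℝ, 0 < ρ → 0 ≤ r → 0 ≤ θ → θ ≤ 2 → 0 < D → 0 ≤ S →
      D ^ 2 = (ρ - r) ^ 2 + ρ * r * θ ^ 2 → S ^ 2 = (ρ + r) ^ 2 - ρ * r * θ ^ 2 →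
      1 < D * (1 + ρ + r) →
      ρ ^ n / (1 + ρ ^ 2) *
        (Real.exp (ρ ^ 2 / 2 - r ^ 2 / 2 - D * S / 2) * quotProfile n D S) ≤
      K * ((1 / max θ (1 / (1 + r ^ 2))) ^ n / (1 + r ^ 2)) := by
  obtain ⟨K, hK, hKb⟩ := exists_pow_mul_exp_le n (a := 4) (b := 7) (c := 1 / 4) (by norm_num)
  refine ⟨2 * 7 ^ n + 4 * K, by positivity,
    fun ρ r θ D S hρ hr hθ hθ2 hD hS hD2 hS2 hG => ?_⟩
  obtain ⟨he1, he2⟩ := eta_decay hρ hr hθ hθ2 hD hS hD2 hS2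
  set e := Real.exp (ρ ^ 2 / 2 - r ^ 2 / 2 - D * S / 2) with he
  set m := max θ (1 / (1 + r ^ 2)) with hm
  have hr2 : 0 < 1 + r ^ 2 := by positivity
  have hm0 : 0 < m := lt_max_of_lt_right (by positivity)
  have h1 : ρ * m ≤ 7 * D := mul_angle_le hρ hr hθ hD hD2 hθ2 hG
  have hT1 : ρ ^ n / (1 + ρ ^ 2) * (e * (1 / D) ^ n) ≤
      2 * 7 ^ n * ((1 / m) ^ n / (1 + r ^ 2)) := by
    have h2 : ρ / D ≤ 7 / m := by
      rw [div_le_div_iff₀ hD hm0]; exact h1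
    calc ρ ^ n / (1 + ρ ^ 2) * (e * (1 / D) ^ n) = (ρ / D) ^ n * (e / (1 + ρ ^ 2)) := by
          rw [div_pow, div_pow, one_pow]; ring
      _ ≤ (7 / m) ^ n * (2 * (1 + ρ ^ 2) / (1 + r ^ 2) / (1 + ρ ^ 2)) := by gcongr
      _ = _ := by rw [div_pow, div_pow, one_pow]; field_simp
  have hT2 : ρ ^ n / (1 + ρ ^ 2) * (e * (√(S / D) * max 0 (1 - D / S)) ^ n) ≤
      4 * K * ((1 / m) ^ n / (1 + r ^ 2)) := by
    rcases le_or_gt S D with hSD | hSD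
    · have hz : √(S / D) * max 0 (1 - D / S) = 0 := by
        rcases hS.eq_or_lt with h | h
        · simp [← h]
        · rw [max_eq_left, mul_zero]
          rw [sub_nonpos, le_div_iff₀ h]; linarith
      rw [hz]
      -- For n = 0 the vanishing base has power 1, so this term survives; K ≥ 1 is then read off at
      -- w = 0.
      rcases Nat.eq_zero_or_pos n with h0 | h0
      · subst h0
        have hK1 : 1 ≤ K := by
          refine le_trans ?_ (hKb 0 (by norm_num)); simp
        simp only [pow_zero, mul_one]
        have : 1 / (1 + ρ ^ 2) * e ≤ 1 / (1 + ρ ^ 2) * (2 * (1 + ρ ^ 2) / (1 + r ^ 2)) := by gcongr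
        refine this.trans ?_
        rw [show 1 / (1 + ρ ^ 2) * (2 * (1 + ρ ^ 2) / (1 + r ^ 2)) = 2 * (1 / (1 + r ^ 2)) by
          field_simp]
        gcongr; linarith
      · rw [zero_pow h0.ne']; simp only [mul_zero]; positivity
    · have hS0 : 0 < S := hD.trans hSD
      have hDS0 : 0 < D * S := by positivity
      set w := ρ * r * θ / √(D * S) with hw
      have hw0 : 0 ≤ w := by positivity
      have hb : D / S < 1 := (div_lt_one hS0).2 hSD
      rw [max_eq_right (by linarith)]
      have hQ0 : 0 ≤ √(S / D) * (1 - D / S) := mul_nonneg (by positivity) (by linarith)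
      have hcomb := sqrt_mul_angle_le hρ hr hθ hD hD2 hS2 hSD hG
      rw [← hw, ← hm] at hcomb
      have h8 : √(S / D) * (1 - D / S) * ρ ≤ (4 * w + 7) / m := by
        rwa [le_div_iff₀ hm0]
      calc ρ ^ n / (1 + ρ ^ 2) * (e * (√(S / D) * (1 - D / S)) ^ n)
          = (√(S / D) * (1 - D / S) * ρ) ^ n * (e / (1 + ρ ^ 2)) := by
            rw [mul_pow _ ρ]; ring
        _ ≤ ((4 * w + 7) / m) ^ n *
            (Real.exp (-(1 / 4 * w ^ 2)) * (4 * (1 + ρ ^ 2) / (1 + r ^ 2)) / (1 + ρ ^ 2)) := by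
            have := he2 hSD
            have h9 := mul_nonneg hQ0 hρ.le
            gcongr
        _ = ((4 * w + 7) ^ n * Real.exp (-(1 / 4 * w ^ 2))) *
              (4 * ((1 / m) ^ n / (1 + r ^ 2))) := by
            rw [div_pow _ m, div_pow _ m, one_pow]; field_simp
        _ ≤ K * (4 * ((1 / m) ^ n / (1 + r ^ 2))) := by
            gcongr; exact hKb w (by positivity)
        _ = _ := by ring
  calc _ = ρ ^ n / (1 + ρ ^ 2) * (e * (1 / D) ^ n) +
        ρ ^ n / (1 + ρ ^ 2) * (e * (√(S / D) * max 0 (1 - D / S)) ^ n) := by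
        unfold quotProfile; ring
    _ ≤ _ := add_le_add hT1 hT2
    _ = _ := by ring

/-! ### Polar identities and the closed form of `barK`. -/

lemma rpow_half_eq_sqrt_pow (n : ℕ) {a : ℝ} (ha : 0 ≤ a) : a ^ ((n : ℝ) / 2) = √a ^ n := by
  rw [Real.sqrt_eq_rpow, ← Real.rpow_natCast, ← Real.rpow_mul ha]
  congr 1; ring

variable {n : ℕ}

lemma norm_sub_sq_polar {x : E n} (hx : x ≠ 0) (y : E n) :
    ‖x - y‖ ^ 2 = (‖x‖ - ‖y‖) ^ 2 + ‖x‖ * ‖y‖ * ‖‖x‖⁻¹ • x - ‖y‖⁻¹ • y‖ ^ 2 := by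
  have hx0 : ‖x‖ ≠ 0 := norm_ne_zero_iff.2 hx
  rcases eq_or_ne y 0 with rfl | hy
  · simp
  have hy0 : ‖y‖ ≠ 0 := norm_ne_zero_iff.2 hy
  rw [norm_sub_sq_real, norm_sub_sq_real, norm_smul, norm_smul, inner_smul_left, inner_smul_right]
  simp only [norm_inv, norm_norm, map_inv₀, RCLike.conj_to_real]
  field_simp
  ring

lemma norm_add_sq_polar {x : E n} (hx : x ≠ 0) (y : E n) :
    ‖x + y‖ ^ 2 = (‖x‖ + ‖y‖) ^ 2 - ‖x‖ * ‖y‖ * ‖‖x‖⁻¹ • x - ‖y‖⁻¹ • y‖ ^ 2 := by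
  have h1 := norm_sub_sq_polar hx y
  have h2 := parallelogram_law_with_norm ℝ x y
  nlinarith

lemma norm_inv_smul_sub_le (x y : E n) : ‖‖x‖⁻¹ • x - ‖y‖⁻¹ • y‖ ≤ 2 := by
  have h : ∀ z : E n, ‖‖z‖⁻¹ • z‖ ≤ 1 := fun z => by
    rw [norm_smul, norm_inv, norm_norm]; exact inv_mul_le_one
  linarith [norm_sub_le (‖x‖⁻¹ • x) (‖y‖⁻¹ • y), h x, h y]

lemma mem_globalRegion_iff (x y : E n) :
    (x, y) ∈ globalRegion n ↔ 1 < ‖x - y‖ * (1 + ‖x‖ + ‖y‖) := by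
  simp only [globalRegion, localRegion, Set.mem_compl_iff, Set.mem_ofPred_eq, not_le]
  rw [div_lt_iff₀ (by positivity)]

lemma norm_sub_pos_of_mem_globalRegion {x y : E n} (h : (x, y) ∈ globalRegion n) :
    0 < ‖x - y‖ := by
  rw [mem_globalRegion_iff] at h
  by_contra h0
  have : ‖x - y‖ = 0 := le_antisymm (not_lt.1 h0) (norm_nonneg _)
  rw [this] at h; norm_num at h

lemma measurableSet_globalRegion : MeasurableSet (globalRegion n) := by
  unfold globalRegion localRegion
  apply MeasurableSet.compl
  apply measurableSet_le <;> fun_prop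

lemma quotPhi_eq_quotProfile (hn : 1 ≤ n) {x y : E n} (h : 0 < ‖x - y‖) :
    quotPhi x y = quotProfile n ‖x - y‖ ‖x + y‖ := by
  have hn0 : n ≠ 0 := by omega
  unfold quotPhi quotProfile
  split_ifs with h0
  -- With S = 0, Lean's D/S is 0 and the positive part is 1, but √(S/D) = 0 kills the second term
  -- because n ≥ 1.
  · simp [h0, hn0]
  · have hS : 0 < ‖x + y‖ := norm_pos_iff.2 h0
    have hsq : ∀ D S : ℝ, 0 < D → 0 < S → √(S / D) / √(D * S) = 1 / D := by
      intro D S hD hS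
      rw [← Real.sqrt_div (by positivity), show S / D / (D * S) = (1 / D) ^ 2 by field_simp,
        Real.sqrt_sq (by positivity)]
    have hmain : (‖x + y‖ / ‖x - y‖) ^ ((n : ℝ) / 2) * (1 / alpha x y ^ ((n : ℝ) / 2)) =
        (1 / ‖x - y‖) ^ n := by
      rw [rpow_half_eq_sqrt_pow n (by positivity),
        rpow_half_eq_sqrt_pow n (by unfold alpha; positivity), alpha, mul_one_div, ← div_pow,
        hsq _ _ h hS]
    unfold Phi
    split_ifs with hb
    · have : max 0 (1 - ‖x - y‖ / ‖x + y‖) = 0 := max_eq_left (by unfold beta at hb; linarith)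
      rw [hmain, this, mul_zero, zero_pow hn0, add_zero]
    · have : max 0 (1 - ‖x - y‖ / ‖x + y‖) = 1 - beta x y :=
        max_eq_right (by unfold beta at hb; linarith)
      rw [mul_add, hmain, this, mul_pow, rpow_half_eq_sqrt_pow n (by positivity)]

lemma barK_of_mem {x y : E n} (h : (x, y) ∈ globalRegion n) :
    barK x y = Real.exp (-‖x‖ ^ 2 + ‖y‖ ^ 2) * eta x y * quotPhi x y :=
  Set.indicator_of_mem h _

lemma barK_of_notMem {x y : E n} (h : (x, y) ∉ globalRegion n) : barK x y = 0 :=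
  Set.indicator_of_notMem h _

lemma barK_nonneg (hn : 1 ≤ n) (x y : E n) : 0 ≤ barK x y := by
  by_cases h : (x, y) ∈ globalRegion n
  · rw [barK_of_mem h, quotPhi_eq_quotProfile hn (norm_sub_pos_of_mem_globalRegion h)]
    have := quotProfile_nonneg n (norm_nonneg (x - y)) ‖x + y‖
    unfold eta; positivity
  · rw [barK_of_notMem h]

lemma measurable_barK (hn : 1 ≤ n) :
    Measurable (Function.uncurry fun x y : E n => barK x y) := by
  have heq : (Function.uncurry fun x y : E n => barK x y) = (globalRegion n).indicator
      (fun p => Real.exp (-‖p.1‖ ^ 2 + ‖p.2‖ ^ 2) * eta p.1 p.2 *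
        quotProfile n ‖p.1 - p.2‖ ‖p.1 + p.2‖) := by
    ext ⟨x, y⟩
    by_cases h : (x, y) ∈ globalRegion n
    · rw [Function.uncurry_apply_pair, Set.indicator_of_mem h, barK_of_mem h,
        quotPhi_eq_quotProfile hn (norm_sub_pos_of_mem_globalRegion h)]
    · rw [Function.uncurry_apply_pair, Set.indicator_of_notMem h, barK_of_notMem h]
  rw [heq]
  refine Measurable.indicator ?_ measurableSet_globalRegion
  unfold eta quotProfile
  fun_prop

/-! ### Pointwise bounds for `barK`. -/

/-- The kernel on the sphere which dominates the radial suprema of the weighted kernel. -/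
noncomputable def angularKernel (ω y : E n) : ℝ :=
  (1 / max ‖ω - ‖y‖⁻¹ • y‖ (1 / (1 + ‖y‖ ^ 2))) ^ n / (1 + ‖y‖ ^ 2)

lemma angularKernel_nonneg (ω y : E n) : 0 ≤ angularKernel ω y := by
  unfold angularKernel; positivity

lemma measurable_angularKernel :
    Measurable fun p : E n × E n => angularKernel p.1 p.2 := by
  unfold angularKernel; fun_prop

lemma exists_barK_le_angularKernel (hn : 1 ≤ n) :
    ∃ K : ℝ, 0 < K ∧ ∀ x y : E n, x ≠ 0 →
      Real.exp (‖x‖ ^ 2) * ‖x‖ ^ n / (1 + ‖x‖ ^ 2) * barK x y ≤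
        K * (angularKernel (‖x‖⁻¹ • x) y * Real.exp (‖y‖ ^ 2)) := by
  obtain ⟨K, hK, h⟩ := exists_radial_le n
  refine ⟨K, hK, fun x y hx => ?_⟩
  by_cases hG : (x, y) ∈ globalRegion n
  · have hD := norm_sub_pos_of_mem_globalRegion hG
    have h1 := h ‖x‖ ‖y‖ ‖‖x‖⁻¹ • x - ‖y‖⁻¹ • y‖ ‖x - y‖ ‖x + y‖ (norm_pos_iff.2 hx)
      (norm_nonneg _) (norm_nonneg _) (norm_inv_smul_sub_le x y) hD (norm_nonneg _)
      (norm_sub_sq_polar hx y) (norm_add_sq_polar hx y) ((mem_globalRegion_iff x y).1 hG)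
    rw [barK_of_mem hG, quotPhi_eq_quotProfile hn hD]
    have he : Real.exp (‖x‖ ^ 2) * Real.exp (-‖x‖ ^ 2 + ‖y‖ ^ 2) = Real.exp (‖y‖ ^ 2) := by
      rw [← Real.exp_add]; congr 1; ring
    calc Real.exp (‖x‖ ^ 2) * ‖x‖ ^ n / (1 + ‖x‖ ^ 2) *
          (Real.exp (-‖x‖ ^ 2 + ‖y‖ ^ 2) * eta x y * quotProfile n ‖x - y‖ ‖x + y‖)
        = (Real.exp (‖x‖ ^ 2) * Real.exp (-‖x‖ ^ 2 + ‖y‖ ^ 2)) * (‖x‖ ^ n / (1 + ‖x‖ ^ 2) *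
          (eta x y * quotProfile n ‖x - y‖ ‖x + y‖)) := by ring
      _ ≤ Real.exp (‖y‖ ^ 2) * (K * angularKernel (‖x‖⁻¹ • x) y) := by
          rw [he]
          exact mul_le_mul_of_nonneg_left h1 (Real.exp_pos _).le
      _ = _ := by ring
  · rw [barK_of_notMem hG, mul_zero]
    have := angularKernel_nonneg (‖x‖⁻¹ • x) y
    positivity

/-- For fixed `x` the kernel `barK x y` is bounded with respect to `γ₋₁`. -/
lemma exists_barK_le_exp (hn : 1 ≤ n) (x : E n) :
    ∃ B : ℝ, 0 ≤ B ∧ ∀ y : E n, barK x y ≤ B * Real.exp (‖y‖ ^ 2) := by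
  set a := 2 + 2 * ‖x‖ with ha
  refine ⟨a ^ n + √(1 + 2 * ‖x‖ * a) ^ n, by positivity, fun y => ?_⟩
  by_cases hG : (x, y) ∈ globalRegion n
  · have hD := norm_sub_pos_of_mem_globalRegion hG
    rw [barK_of_mem hG, quotPhi_eq_quotProfile hn hD]
    rw [mem_globalRegion_iff] at hG
    set D := ‖x - y‖ with hDdef
    have hy : ‖y‖ ≤ ‖x‖ + D := by
      have := norm_sub_norm_le y x
      rw [norm_sub_rev] at this; linarith
    have hS : ‖x + y‖ ≤ 2 * ‖x‖ + D := by linarith [norm_add_le x y]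
    -- In the global region 1 < D(1 + 2|x| + D): for D ≤ 1 this gives the bound, and for D > 1 it is
    -- trivial.
    have hDinv : 1 / D ≤ a := by
      rw [div_le_iff₀ hD, ha]
      rcases le_or_gt D 1 with h | h
      · nlinarith
      · nlinarith [norm_nonneg x]
    have hSD : ‖x + y‖ / D ≤ 1 + 2 * ‖x‖ * a := by
      calc ‖x + y‖ / D ≤ (2 * ‖x‖ + D) / D := by gcongr
        _ = 1 + 2 * ‖x‖ * (1 / D) := by field_simp; ring
        _ ≤ _ := by gcongr
    have hmax : max 0 (1 - D / ‖x + y‖) ≤ 1 := by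
      apply max_le zero_le_one
      have : 0 ≤ D / ‖x + y‖ := by positivity
      linarith
    have hQ : quotProfile n D ‖x + y‖ ≤ a ^ n + √(1 + 2 * ‖x‖ * a) ^ n := by
      unfold quotProfile
      gcongr
      calc √(‖x + y‖ / D) * max 0 (1 - D / ‖x + y‖) ≤ √(1 + 2 * ‖x‖ * a) * 1 := by gcongr
        _ = _ := mul_one _
    have heta : eta x y ≤ 1 := by
      unfold eta
      rw [Real.exp_le_one_iff]
      have h1 : ‖x‖ ^ 2 - ‖y‖ ^ 2 = inner ℝ (x - y) (x + y) := by
        rw [inner_add_right, inner_sub_left, inner_sub_left, real_inner_comm x y]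
        simp only [real_inner_self_eq_norm_sq]; ring
      have h2 := real_inner_le_norm (x - y) (x + y)
      linarith
    have heta0 : 0 ≤ eta x y := (Real.exp_pos _).le
    have hQ0 := quotProfile_nonneg n hD.le ‖x + y‖
    calc Real.exp (-‖x‖ ^ 2 + ‖y‖ ^ 2) * eta x y * quotProfile n D ‖x + y‖
        ≤ Real.exp (‖y‖ ^ 2) * 1 * (a ^ n + √(1 + 2 * ‖x‖ * a) ^ n) := by
          gcongr
          nlinarith [sq_nonneg ‖x‖]
      _ = _ := by ring
  · rw [barK_of_notMem hG]; positivity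

/-! ### Domination of the Mehler kernel by `barK`. -/

/-- With q = e^{-t}, one has 1/(1 + q) = (1 + u)/2 and 1/(1 - q) = (1 + u)/(2u), so the negated
exponent is (D² + S²)/4 + (uS² + D²/u)/4. The parallelogram law rewrites the first part, and
completing the square in the second gives DS/2 + (D - uS)²/(4u). -/
lemma mehlerKernel_eq {t : ℝ} (ht : 0 < t) (x y : E n) {u : ℝ}
    (hu : u = (1 - Real.exp (-t)) / (1 + Real.exp (-t))) :
    mehlerKernel t x y = Real.pi ^ ((n : ℝ) / 2) / (2 * Real.pi) ^ n *
      (Real.exp (-‖x‖ ^ 2 + ‖y‖ ^ 2) * eta x y * (((1 - u) / √u) ^ n *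
        Real.exp (-((‖x - y‖ - u * ‖x + y‖) ^ 2 / (4 * u))))) := by
  set q := Real.exp (-t) with hq
  have hq0 : 0 < q := Real.exp_pos _
  have hq1 : q < 1 := by rw [hq, Real.exp_lt_one_iff]; linarith
  have hqn : Real.exp (-(n * t)) = q ^ n := by
    rw [hq, ← Real.exp_nat_mul]; congr 1; ring
  have hq2 : Real.exp (-(2 * t)) = q ^ 2 := by
    rw [hq, ← Real.exp_nat_mul]; congr 1; push_cast; ring
  have h1q : 0 < 1 - q := by linarith
  have h1q2 : 0 < 1 - q ^ 2 := by nlinarith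
  have hu1 : 1 - u = 2 * q / (1 + q) := by rw [hu]; field_simp; ring
  have hsu : (1 + q) * √u = √(1 - q ^ 2) := by
    rw [hu, show 1 - q ^ 2 = (1 + q) ^ 2 * ((1 - q) / (1 + q)) by field_simp; ring,
      Real.sqrt_mul (by positivity), Real.sqrt_sq (by positivity)]
  have hfrac : (1 - u) / √u = 2 * q / √(1 - q ^ 2) := by rw [hu1, div_div, hsu]
  have hpar := parallelogram_law_with_norm ℝ x y
  have hexp : -(‖x + y‖ ^ 2 / (2 * (1 + q))) - ‖x - y‖ ^ 2 / (2 * (1 - q)) =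
      -‖x‖ ^ 2 + (‖x‖ ^ 2 / 2 - ‖y‖ ^ 2 / 2 - ‖x - y‖ * ‖x + y‖ / 2) +
        -((‖x - y‖ - u * ‖x + y‖) ^ 2 / (4 * u)) := by
    have : ‖x‖ ^ 2 = (‖x + y‖ ^ 2 + ‖x - y‖ ^ 2) / 2 - ‖y‖ ^ 2 := by nlinarith
    rw [this, hu]
    field_simp
    ring
  unfold mehlerKernel mehlerKernelGamma density eta
  rw [← hq, hexp, hqn, hq2, hfrac, rpow_half_eq_sqrt_pow n h1q2.le, Real.exp_add, Real.exp_add,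
    Real.exp_add (-‖x‖ ^ 2), div_pow, mul_pow, mul_pow]
  field_simp

lemma mehlerKernel_nonneg {t : ℝ} (ht : 0 < t) (x y : E n) : 0 ≤ mehlerKernel t x y := by
  have : Real.exp (-(2 * t)) ≤ 1 := by rw [Real.exp_le_one_iff]; linarith
  have h2 : 0 ≤ 1 - Real.exp (-(2 * t)) := by linarith
  unfold mehlerKernel mehlerKernelGamma density
  positivity

lemma exists_mehlerKernel_le_barK (hn : 1 ≤ n) :
    ∃ C : ℝ, 0 < C ∧ ∀ t : ℝ, 0 < t → ∀ x y : E n, (x, y) ∈ globalRegion n →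
      mehlerKernel t x y ≤ C * barK x y := by
  obtain ⟨K, hK, h⟩ := exists_mehler_le_quotProfile n
  refine ⟨Real.pi ^ ((n : ℝ) / 2) / (2 * Real.pi) ^ n * K, by positivity,
    fun t ht x y hG => ?_⟩
  have hD := norm_sub_pos_of_mem_globalRegion hG
  have hq0 : 0 < Real.exp (-t) := Real.exp_pos _
  have hq1 : Real.exp (-t) < 1 := by rw [Real.exp_lt_one_iff]; linarith
  rw [mehlerKernel_eq ht x y rfl, barK_of_mem hG, quotPhi_eq_quotProfile hn hD, mul_assoc _ K]
  refine mul_le_mul_of_nonneg_left ?_ (by positivity)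
  rw [mul_left_comm K]
  refine mul_le_mul_of_nonneg_left ?_ (by unfold eta; positivity)
  refine h _ _ _ hD (norm_nonneg _) (div_pos (by linarith) (by positivity)) ?_
  rw [div_lt_one (by positivity)]; linarith

/-! ### Polar integration and the radial weight. -/

/-- Polar coordinates for the Lebesgue integral on `ℝⁿ`. -/
lemma lintegral_polar (hn : 1 ≤ n) {F : E n → ℝ≥0∞} (hF : Measurable F) :
    ∫⁻ x, F x = ∫⁻ ω : Metric.sphere (0 : E n) 1, (∫⁻ r in Set.Ioi (0 : ℝ),
      ENNReal.ofReal (r ^ (n - 1)) * F (r • (ω : E n))) ∂(volume : Measure (E n)).toSphere := by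
  have : Nonempty (Fin n) := ⟨⟨0, hn⟩⟩
  have hmp := (volume : Measure (E n)).measurePreserving_homeomorphUnitSphereProd
  have hdim : Module.finrank ℝ (E n) = n := by simp
  have hcont : Measurable fun p : Metric.sphere (0 : E n) 1 × Set.Ioi (0 : ℝ) =>
      F ((p.2 : ℝ) • (p.1 : E n)) := by
    refine hF.comp ?_
    fun_prop
  calc ∫⁻ x, F x = ∫⁻ x in ({0}ᶜ : Set (E n)), F x := by rw [restrict_compl_singleton]
    _ = ∫⁻ x : ({0}ᶜ : Set (E n)), F x ∂(Measure.comap Subtype.val volume) :=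
        (lintegral_subtype_comap (measurableSet_singleton _).compl F).symm
    _ = ∫⁻ x : ({0}ᶜ : Set (E n)),
          (fun p : Metric.sphere (0 : E n) 1 × Set.Ioi (0 : ℝ) => F ((p.2 : ℝ) • (p.1 : E n)))
            (homeomorphUnitSphereProd (E n) x) ∂(Measure.comap Subtype.val volume) := by
        refine lintegral_congr fun x => ?_
        have h0 : ‖(x : E n)‖ ≠ 0 := norm_ne_zero_iff.2 x.2
        simp [smul_smul, h0]
    _ = ∫⁻ p, F ((p.2 : ℝ) • (p.1 : E n)) ∂((volume : Measure (E n)).toSphere.prod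
          (Measure.volumeIoiPow (Module.finrank ℝ (E n) - 1))) :=
        hmp.lintegral_comp hcont
    _ = _ := by
        rw [lintegral_prod _ hcont.aemeasurable, hdim]
        refine lintegral_congr fun ω => ?_
        have hm : Measurable fun r : ℝ => F (r • (ω : E n)) := hF.comp (by fun_prop)
        exact (lintegral_withDensity_eq_lintegral_mul _ (by fun_prop)
          (hm.comp measurable_subtype_coe)).trans (lintegral_subtype_comap measurableSet_Ioi
            fun r : ℝ => ENNReal.ofReal (r ^ (n - 1)) * F (r • (ω : E n)))

lemma hasDerivAt_radialWeight (n : ℕ) (r : ℝ) :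
    HasDerivAt (fun r : ℝ => Real.exp (r ^ 2) * r ^ n / (1 + r ^ 2))
      (((Real.exp (r ^ 2) * (2 * r) * r ^ n + Real.exp (r ^ 2) * (n * r ^ (n - 1))) *
        (1 + r ^ 2) - Real.exp (r ^ 2) * r ^ n * (2 * r)) / (1 + r ^ 2) ^ 2) r := by
  have h0 : HasDerivAt (fun r : ℝ => r ^ 2) (2 * r) r := by simpa using hasDerivAt_pow 2 r
  exact (h0.exp.mul (hasDerivAt_pow n r)).div (h0.const_add 1) (by positivity)

/-- The numerator is e^{r²} r^{n-1} (n(1 + r²) + 2r⁴), and the last factor is at least (1 + r²)²/2.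
-/
lemma le_deriv_radialWeight (hn : 1 ≤ n) {r : ℝ} (hr : 0 < r) :
    1 / 2 * (Real.exp (r ^ 2) * r ^ (n - 1)) ≤
      ((Real.exp (r ^ 2) * (2 * r) * r ^ n + Real.exp (r ^ 2) * (n * r ^ (n - 1))) *
        (1 + r ^ 2) - Real.exp (r ^ 2) * r ^ n * (2 * r)) / (1 + r ^ 2) ^ 2 := by
  obtain ⟨m, rfl⟩ : ∃ m, n = m + 1 := ⟨n - 1, by omega⟩
  rw [le_div_iff₀ (by positivity)]
  have heq : (Real.exp (r ^ 2) * (2 * r) * r ^ (m + 1) +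
      Real.exp (r ^ 2) * ((m + 1 : ℕ) * r ^ (m + 1 - 1))) * (1 + r ^ 2) -
      Real.exp (r ^ 2) * r ^ (m + 1) * (2 * r) =
      Real.exp (r ^ 2) * r ^ m * ((m + 1) * (1 + r ^ 2) + 2 * r ^ 4) := by
    push_cast [Nat.add_sub_cancel]; ring
  rw [heq, Nat.add_sub_cancel, show 1 / 2 * (Real.exp (r ^ 2) * r ^ m) * (1 + r ^ 2) ^ 2 =
    Real.exp (r ^ 2) * r ^ m * (1 / 2 * (1 + r ^ 2) ^ 2) by ring]
  refine mul_le_mul_of_nonneg_left ?_ (by positivity)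
  have hm : (0 : ℝ) ≤ m := Nat.cast_nonneg m
  nlinarith [mul_nonneg hm (by positivity : (0 : ℝ) ≤ 1 + r ^ 2), sq_nonneg (r ^ 2)]

/-- The density is at most 2φ', and by the change of variables for the monotone φ the integral of φ'
over this set is the length of its image, which lies in [0, T]. -/
lemma setLIntegral_radial_le (hn : 1 ≤ n) (T : ℝ≥0∞) :
    ∫⁻ r in {r : ℝ | 0 < r ∧ ENNReal.ofReal (Real.exp (r ^ 2) * r ^ n / (1 + r ^ 2)) ≤ T},
      ENNReal.ofReal (Real.exp (r ^ 2) * r ^ (n - 1)) ≤ 2 * T := by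
  rcases eq_or_ne T ⊤ with rfl | hT
  · simp
  set U := {r : ℝ | 0 < r ∧ ENNReal.ofReal (Real.exp (r ^ 2) * r ^ n / (1 + r ^ 2)) ≤ T} with hU
  set φ := fun r : ℝ => Real.exp (r ^ 2) * r ^ n / (1 + r ^ 2) with hφ
  set φ' := fun r : ℝ => ((Real.exp (r ^ 2) * (2 * r) * r ^ n +
    Real.exp (r ^ 2) * (n * r ^ (n - 1))) * (1 + r ^ 2) -
      Real.exp (r ^ 2) * r ^ n * (2 * r)) / (1 + r ^ 2) ^ 2 with hφ'
  have hUm : MeasurableSet U := by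
    have h : MeasurableSet {r : ℝ | ENNReal.ofReal (φ r) ≤ T} :=
      measurableSet_le (by simp only [hφ]; fun_prop) measurable_const
    exact measurableSet_Ioi.inter h
  have hmono : MonotoneOn φ (Set.Ioi 0) := by
    refine monotoneOn_of_hasDerivWithinAt_nonneg (f' := φ') (convex_Ioi 0)
      (fun r _ => (hasDerivAt_radialWeight n r).continuousAt.continuousWithinAt)
      (fun r _ => (hasDerivAt_radialWeight n r).hasDerivWithinAt) (fun r hr => ?_)
    rw [interior_Ioi] at hr
    have hr0 : 0 < r := hr
    exact le_trans (by positivity) (le_deriv_radialWeight hn hr0)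
  have hUI : U ⊆ Set.Ioi 0 := fun r hr => hr.1
  have key := lintegral_image_eq_lintegral_deriv_mul_of_monotoneOn hUm
    (fun r _ => (hasDerivAt_radialWeight n r).hasDerivWithinAt) (hmono.mono hUI) (fun _ => 1)
  have himg : φ '' U ⊆ Set.Icc 0 T.toReal := by
    rintro _ ⟨r, hr, rfl⟩
    have hr0 : 0 < r := hr.1
    refine ⟨by simp only [hφ]; positivity, ?_⟩
    exact (ENNReal.ofReal_le_iff_le_toReal hT).1 hr.2
  have hvol : ∫⁻ _ in φ '' U, (1 : ℝ≥0∞) ≤ T := by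
    rw [setLIntegral_one]
    refine (measure_mono himg).trans ?_
    rw [Real.volume_Icc, sub_zero, ENNReal.ofReal_toReal hT]
  calc ∫⁻ r in U, ENNReal.ofReal (Real.exp (r ^ 2) * r ^ (n - 1))
      ≤ ∫⁻ r in U, 2 * (ENNReal.ofReal (φ' r) * 1) := by
        refine setLIntegral_mono' hUm fun r hr => ?_
        rw [mul_one, ← ENNReal.ofReal_ofNat, ← ENNReal.ofReal_mul (by norm_num)]
        apply ENNReal.ofReal_le_ofReal
        have := le_deriv_radialWeight hn hr.1
        simp only [hφ']
        linarith
    _ = 2 * ∫⁻ r in U, ENNReal.ofReal (φ' r) * 1 := lintegral_const_mul' _ _ (by norm_num)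
    _ ≤ 2 * T := by rw [← key]; gcongr

/-! ### Spherical caps and the integral of the angular kernel. -/

open scoped Pointwise in
/-- Spherical caps of radius `r` have surface measure `O(r^{n-1})`. -/
lemma exists_toSphere_cap_le (hn : 1 ≤ n) :
    ∃ C : ℝ, 0 ≤ C ∧ ∀ e : E n, ‖e‖ ≤ 1 → ∀ r : ℝ, 0 < r →
      (volume : Measure (E n)).toSphere {ω | ‖(ω : E n) - e‖ ≤ r} ≤
        ENNReal.ofReal (C * r ^ (n - 1)) := by
  set σ := (volume : Measure (E n)).toSphere with hσ
  set c := (volume (Metric.ball (0 : E n) 1)).toReal with hc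
  have hcb : volume (Metric.ball (0 : E n) 1) = ENNReal.ofReal c :=
    (ENNReal.ofReal_toReal measure_ball_lt_top.ne).symm
  have hdim : Module.finrank ℝ (E n) = n := by simp
  set M := (σ Set.univ).toReal with hM
  have hMu : σ Set.univ = ENNReal.ofReal M :=
    (ENNReal.ofReal_toReal (measure_lt_top _ _).ne).symm
  have hc0 : 0 ≤ c := ENNReal.toReal_nonneg
  have hM0 : 0 ≤ M := ENNReal.toReal_nonneg
  refine ⟨n * (2 * 2 ^ n * c) + M, by positivity, fun e he r hr => ?_⟩
  rcases le_or_gt 1 r with h1 | h1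
  · refine (measure_mono (Set.subset_univ _)).trans ?_
    rw [hMu]
    apply ENNReal.ofReal_le_ofReal
    have hp : 1 ≤ r ^ (n - 1) := one_le_pow₀ h1
    have : 0 ≤ n * (2 * 2 ^ n * c) := by positivity
    nlinarith
  · have hms : MeasurableSet {ω : Metric.sphere (0 : E n) 1 | ‖(ω : E n) - e‖ ≤ r} :=
      measurableSet_le (by fun_prop) measurable_const
    rw [hσ, Measure.toSphere_apply' _ hms, hdim]
    set N := ⌊1 / r⌋₊ with hN
    -- Surface measure is n times the volume of the cone over the cap. A point tω is within r of te,
    -- and te is within r of the multiple ⌊t/r⌋ r e, so at most 2/r balls of radius 2r cover the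
    -- cone.
    have hsub : Set.Ioo (0 : ℝ) 1 • (Subtype.val '' {ω : Metric.sphere (0 : E n) 1 |
        ‖(ω : E n) - e‖ ≤ r}) ⊆
        ⋃ j ∈ Finset.range (N + 1), Metric.closedBall ((j * r : ℝ) • e) (2 * r) := by
      rintro _ ⟨t, ht, _, ⟨ω, hω, rfl⟩, rfl⟩
      simp only [Set.mem_iUnion, Finset.mem_range, exists_prop]
      have htr : 0 ≤ t / r := div_nonneg ht.1.le hr.le
      refine ⟨⌊t / r⌋₊, ?_, ?_⟩
      · refine Nat.lt_succ_of_le (Nat.floor_le_floor ?_)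
        have := ht.2.le
        gcongr
      · have h2 := Nat.floor_le htr
        have h3 := Nat.lt_floor_add_one (t / r)
        rw [le_div_iff₀ hr] at h2
        rw [div_lt_iff₀ hr] at h3
        rw [Metric.mem_closedBall, dist_eq_norm]
        have h4 : t • (ω : E n) - ((⌊t / r⌋₊ * r : ℝ)) • e =
          t • ((ω : E n) - e) + (t - ⌊t / r⌋₊ * r) • e := by
          rw [smul_sub, sub_smul]; abel
        have h5 : ‖t • ((ω : E n) - e)‖ ≤ 1 * r := by
          rw [norm_smul, Real.norm_of_nonneg ht.1.le]
          exact mul_le_mul ht.2.le hω (norm_nonneg _) zero_le_one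
        have h6 : ‖(t - ⌊t / r⌋₊ * r) • e‖ ≤ r * 1 := by
          rw [norm_smul, Real.norm_of_nonneg (by linarith)]
          exact mul_le_mul (by linarith) he (norm_nonneg _) hr.le
        change ‖t • (ω : E n) - ((⌊t / r⌋₊ * r : ℝ)) • e‖ ≤ 2 * r
        rw [h4]
        linarith [norm_add_le (t • ((ω : E n) - e)) ((t - ⌊t / r⌋₊ * r) • e)]
    have hN1 : ((N + 1 : ℕ) : ℝ) ≤ 2 / r := by
      push_cast
      have := Nat.floor_le (show 0 ≤ 1 / r by positivity)
      have h1r : 1 ≤ 1 / r := by rw [le_div_iff₀ hr]; linarith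
      rw [show 2 / r = 1 / r + 1 / r by ring]
      linarith
    calc (n : ℝ≥0∞) * volume (Set.Ioo (0 : ℝ) 1 • (Subtype.val '' {ω : Metric.sphere (0 : E n) 1 |
          ‖(ω : E n) - e‖ ≤ r}))
        ≤ n * ∑ j ∈ Finset.range (N + 1),
            volume (Metric.closedBall ((j * r : ℝ) • e) (2 * r)) := by
          gcongr
          exact (measure_mono hsub).trans (measure_biUnion_finset_le _ _)
      _ = ENNReal.ofReal n * (ENNReal.ofReal ((N + 1 : ℕ) : ℝ) *
            (ENNReal.ofReal ((2 * r) ^ n) * ENNReal.ofReal c)) := by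
          simp only [Measure.addHaar_closedBall _ _ (show 0 ≤ 2 * r by positivity), hdim, hcb,
            Finset.sum_const, Finset.card_range, nsmul_eq_mul, ENNReal.ofReal_natCast]
      _ = ENNReal.ofReal (n * (((N + 1 : ℕ) : ℝ) * ((2 * r) ^ n * c))) := by
          rw [← ENNReal.ofReal_mul (by positivity), ← ENNReal.ofReal_mul (by positivity),
            ← ENNReal.ofReal_mul (by positivity)]
      _ ≤ _ := by
          apply ENNReal.ofReal_le_ofReal
          have hpow : (2 * r) ^ n = 2 ^ n * (r ^ (n - 1) * r) := by
            rw [mul_pow, pow_sub_one_mul (by omega)]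
          have hstep : ((N + 1 : ℕ) : ℝ) * ((2 * r) ^ n * c) ≤ 2 * 2 ^ n * c * r ^ (n - 1) := by
            calc ((N + 1 : ℕ) : ℝ) * ((2 * r) ^ n * c) ≤ 2 / r * ((2 * r) ^ n * c) := by gcongr
              _ = _ := by rw [hpow]; field_simp
          have hMr : 0 ≤ M * r ^ (n - 1) := by positivity
          calc (n : ℝ) * (((N + 1 : ℕ) : ℝ) * ((2 * r) ^ n * c))
              ≤ n * (2 * 2 ^ n * c * r ^ (n - 1)) := by gcongr
            _ ≤ _ := by rw [add_mul]; linarith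

/-- Dyadic decomposition: at distance about 2^k ε the integrand is of order (2^k ε)^{-n} and the cap
has measure O((2^k ε)^{n-1}), so the contributions O(2^{-k}/ε) sum geometrically. -/
lemma exists_lintegral_sphere_le (hn : 1 ≤ n) :
    ∃ C : ℝ, 0 ≤ C ∧ ∀ e : E n, ‖e‖ ≤ 1 → ∀ ε : ℝ, 0 < ε →
      ∫⁻ ω : Metric.sphere (0 : E n) 1, ENNReal.ofReal ((1 / max ‖(ω : E n) - e‖ ε) ^ n)
        ∂(volume : Measure (E n)).toSphere ≤ ENNReal.ofReal (C / ε) := by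
  obtain ⟨C, hC, hcap⟩ := exists_toSphere_cap_le hn
  refine ⟨2 ^ n * C * 2, by positivity, fun e he ε hε => ?_⟩
  set cap := fun k : ℕ => {ω : Metric.sphere (0 : E n) 1 | ‖(ω : E n) - e‖ ≤ 2 ^ k * ε} with hcapdef
  have hms : ∀ k, MeasurableSet (cap k) := fun k =>
    measurableSet_le (by fun_prop) measurable_const
  set a := fun k : ℕ => (2 / (2 ^ k * ε)) ^ n with ha
  have hpt : ∀ ω : Metric.sphere (0 : E n) 1,
      ENNReal.ofReal ((1 / max ‖(ω : E n) - e‖ ε) ^ n) ≤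
        ∑' k, (cap k).indicator (fun _ => ENNReal.ofReal (a k)) ω := by
    intro ω
    set m := max ‖(ω : E n) - e‖ ε with hm
    have hm0 : 0 < m := lt_max_of_lt_right hε
    have hex : ∃ k : ℕ, m ≤ 2 ^ k * ε := by
      obtain ⟨k, hk⟩ := pow_unbounded_of_one_lt (m / ε) (one_lt_two (α := ℝ))
      exact ⟨k, ((div_lt_iff₀ hε).1 hk).le⟩
    classical
    set k := Nat.find hex with hk
    have hk1 : m ≤ 2 ^ k * ε := Nat.find_spec hex
    refine le_trans ?_ (ENNReal.le_tsum k)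
    rw [Set.indicator_of_mem (show ω ∈ cap k from (le_max_left _ _).trans hk1)]
    apply ENNReal.ofReal_le_ofReal
    simp only [ha]
    gcongr ?_ ^ n
    rw [div_le_div_iff₀ hm0 (by positivity), one_mul]
    rcases Nat.eq_zero_or_pos k with h0 | h0
    · rw [h0, pow_zero, one_mul]
      have : ε ≤ m := le_max_right _ _
      linarith
    · have hlt := Nat.find_min hex (Nat.sub_lt h0 one_pos)
      rw [not_le, ← hk] at hlt
      have : (2 : ℝ) ^ k = 2 ^ (k - 1) * 2 := (pow_sub_one_mul h0.ne' _).symm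
      rw [this]; linarith
  have hterm : ∀ k, ENNReal.ofReal (a k) * (volume : Measure (E n)).toSphere (cap k) ≤
      ENNReal.ofReal (2 ^ n * C / ε * (1 / 2) ^ k) := by
    intro k
    refine (mul_le_mul_right (hcap e he _ (by positivity)) _).trans ?_
    rw [← ENNReal.ofReal_mul (by simp only [ha]; positivity)]
    apply ENNReal.ofReal_le_ofReal
    apply le_of_eq
    simp only [ha]
    have hpow : (2 ^ k * ε) ^ n = (2 ^ k * ε) ^ (n - 1) * (2 ^ k * ε) :=
      (pow_sub_one_mul (by omega) _).symm
    rw [div_pow, hpow, one_div, inv_pow]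
    field_simp
  calc ∫⁻ ω : Metric.sphere (0 : E n) 1, ENNReal.ofReal ((1 / max ‖(ω : E n) - e‖ ε) ^ n)
        ∂(volume : Measure (E n)).toSphere
      ≤ ∫⁻ ω, ∑' k, (cap k).indicator (fun _ => ENNReal.ofReal (a k)) ω
        ∂(volume : Measure (E n)).toSphere := lintegral_mono hpt
    _ = ∑' k, ENNReal.ofReal (a k) * (volume : Measure (E n)).toSphere (cap k) := by
        rw [lintegral_tsum fun k => (measurable_const.indicator (hms k)).aemeasurable]
        simp only [lintegral_indicator_const (hms _)]
    _ ≤ ∑' k : ℕ, ENNReal.ofReal (2 ^ n * C / ε * (1 / 2) ^ k) := ENNReal.tsum_le_tsum hterm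
    _ = ENNReal.ofReal (∑' k : ℕ, 2 ^ n * C / ε * (1 / 2) ^ k) :=
        (ENNReal.ofReal_tsum_of_nonneg (fun k => by positivity)
          (summable_geometric_two.mul_left _)).symm
    _ = _ := by
        rw [tsum_mul_left, tsum_geometric_two]
        congr 1; ring

/-- With ε = 1/(1 + |y|²), the loss 1/ε is exactly compensated by the factor 1/(1 + |y|²) in the
kernel. -/
lemma exists_lintegral_angularKernel_le (hn : 1 ≤ n) :
    ∃ C : ℝ, 0 ≤ C ∧ ∀ y : E n,
      ∫⁻ ω : Metric.sphere (0 : E n) 1, ENNReal.ofReal (angularKernel (ω : E n) y)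
        ∂(volume : Measure (E n)).toSphere ≤ ENNReal.ofReal C := by
  obtain ⟨C, hC, h⟩ := exists_lintegral_sphere_le hn
  refine ⟨C, hC, fun y => ?_⟩
  -- Only an inequality: at y = 0 the direction is the zero vector.
  have hy : ‖‖y‖⁻¹ • y‖ ≤ 1 := by
    rw [norm_smul, norm_inv, norm_norm]; exact inv_mul_le_one
  have h1 := h _ hy (1 / (1 + ‖y‖ ^ 2)) (by positivity)
  have hy2 : 0 < 1 + ‖y‖ ^ 2 := by positivity
  calc ∫⁻ ω : Metric.sphere (0 : E n) 1, ENNReal.ofReal (angularKernel (ω : E n) y)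
        ∂(volume : Measure (E n)).toSphere
      = ENNReal.ofReal (1 / (1 + ‖y‖ ^ 2)) * ∫⁻ ω : Metric.sphere (0 : E n) 1,
          ENNReal.ofReal ((1 / max ‖(ω : E n) - ‖y‖⁻¹ • y‖ (1 / (1 + ‖y‖ ^ 2))) ^ n)
          ∂(volume : Measure (E n)).toSphere := by
        rw [← lintegral_const_mul' _ _ ENNReal.ofReal_ne_top]
        refine lintegral_congr fun ω => ?_
        rw [← ENNReal.ofReal_mul (by positivity), angularKernel]
        congr 1; ring
    _ ≤ ENNReal.ofReal (1 / (1 + ‖y‖ ^ 2)) * ENNReal.ofReal (C / (1 / (1 + ‖y‖ ^ 2))) := by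
        gcongr
    _ = ENNReal.ofReal C := by
        rw [← ENNReal.ofReal_mul (by positivity)]
        congr 1; field_simp

/-! ### Weak type estimate for the positive kernel. -/

lemma measurable_density : Measurable (density : E n → ℝ) := by
  unfold density; fun_prop

/-- The exponential measure of a star-shaped region, given by a direction-dependent bound on the
radial weight. -/
lemma setLIntegral_exp_sq_le (hn : 1 ≤ n) {A : E n → ℝ≥0∞} (hA : Measurable A) {U : Set (E n)}
    (hU : U = {x : E n | ENNReal.ofReal (Real.exp (‖x‖ ^ 2) * ‖x‖ ^ n / (1 + ‖x‖ ^ 2)) ≤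
      A (‖x‖⁻¹ • x)}) :
    MeasurableSet U ∧ ∫⁻ x in U, ENNReal.ofReal (Real.exp (‖x‖ ^ 2)) ≤
      2 * ∫⁻ ω : Metric.sphere (0 : E n) 1, A (ω : E n) ∂(volume : Measure (E n)).toSphere := by
  have hUm : MeasurableSet U := by
    rw [hU]
    refine measurableSet_le (by fun_prop) (hA.comp ?_)
    fun_prop
  refine ⟨hUm, ?_⟩
  rw [← lintegral_indicator hUm, lintegral_polar hn (Measurable.indicator (by fun_prop) hUm),
    ← lintegral_const_mul' _ _ (by norm_num)]
  refine lintegral_mono fun ω => ?_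
  refine le_trans (le_of_eq ?_) (setLIntegral_radial_le hn (A (ω : E n)))
  have hmr : Measurable fun r : ℝ =>
      ENNReal.ofReal (Real.exp (r ^ 2) * r ^ n / (1 + r ^ 2)) := by fun_prop
  have hVm : MeasurableSet {r : ℝ | 0 < r ∧ ENNReal.ofReal
      (Real.exp (r ^ 2) * r ^ n / (1 + r ^ 2)) ≤ A (ω : E n)} := by
    have h : MeasurableSet {r : ℝ | ENNReal.ofReal
        (Real.exp (r ^ 2) * r ^ n / (1 + r ^ 2)) ≤ A (ω : E n)} :=
      measurableSet_le hmr measurable_const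
    exact measurableSet_Ioi.inter h
  rw [← lintegral_indicator hVm, ← lintegral_indicator measurableSet_Ioi]
  refine lintegral_congr fun r => ?_
  by_cases hr : 0 < r
  · have hω : ‖(ω : E n)‖ = 1 := by simp
    have hnorm : ‖r • (ω : E n)‖ = r := by
      rw [norm_smul, hω, mul_one, Real.norm_of_nonneg hr.le]
    have hdir : r⁻¹ • (r • (ω : E n)) = ω := by
      rw [smul_smul, inv_mul_cancel₀ hr.ne', one_smul]
    have hiff : r • (ω : E n) ∈ U ↔ r ∈ {r : ℝ | 0 < r ∧ ENNReal.ofReal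
        (Real.exp (r ^ 2) * r ^ n / (1 + r ^ 2)) ≤ A (ω : E n)} := by
      simp only [hU, Set.mem_ofPred_eq, hnorm, hdir, hr, true_and]
    rw [Set.indicator_of_mem (show r ∈ Set.Ioi (0 : ℝ) from hr)]
    by_cases hmem : r • (ω : E n) ∈ U
    · rw [Set.indicator_of_mem hmem, Set.indicator_of_mem (hiff.1 hmem), hnorm,
        ← ENNReal.ofReal_mul (by positivity), mul_comm]
    · rw [Set.indicator_of_notMem hmem, Set.indicator_of_notMem (fun h => hmem (hiff.2 h)),
        mul_zero]
  · rw [Set.indicator_of_notMem (fun h : r ∈ Set.Ioi (0 : ℝ) => hr h),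
      Set.indicator_of_notMem (fun h => hr h.1)]

lemma lintegral_sphere_angularKernel_le {K C : ℝ} (hK : 0 ≤ K)
    (hC : ∀ y : E n, ∫⁻ ω : Metric.sphere (0 : E n) 1, ENNReal.ofReal (angularKernel (ω : E n) y)
        ∂(volume : Measure (E n)).toSphere ≤ ENNReal.ofReal C)
    {g : E n → ℝ≥0∞} (hg : Measurable g) :
    ∫⁻ ω : Metric.sphere (0 : E n) 1, (∫⁻ y, ENNReal.ofReal (K * angularKernel (ω : E n) y) * g y)
      ∂(volume : Measure (E n)).toSphere ≤ ENNReal.ofReal (K * C) * ∫⁻ y, g y := by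
  set k : Metric.sphere (0 : E n) 1 → E n → ℝ≥0∞ :=
    fun ω y => ENNReal.ofReal (K * angularKernel (ω : E n) y) with hk
  have hm : Measurable (Function.uncurry k) := by
    have h : Measurable fun q : Metric.sphere (0 : E n) 1 × E n =>
        angularKernel (q.1 : E n) q.2 := by
      unfold angularKernel; fun_prop
    exact (h.const_mul K).ennreal_ofReal
  have hky : ∀ y, ∫⁻ ω, k ω y ∂(volume : Measure (E n)).toSphere ≤ ENNReal.ofReal (K * C) := by
    intro y
    simp only [hk, ENNReal.ofReal_mul hK]
    rw [lintegral_const_mul' _ _ ENNReal.ofReal_ne_top]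
    exact mul_le_mul_right (hC y) _
  change ∫⁻ ω, (∫⁻ y, k ω y * g y) ∂(volume : Measure (E n)).toSphere ≤ _
  clear_value k
  calc ∫⁻ ω, (∫⁻ y, k ω y * g y) ∂(volume : Measure (E n)).toSphere
      = ∫⁻ y, (∫⁻ ω, k ω y * g y ∂(volume : Measure (E n)).toSphere) :=
        lintegral_lintegral_swap (hm.mul (hg.comp measurable_snd)).aemeasurable
    _ ≤ ∫⁻ y, ENNReal.ofReal (K * C) * g y := by
        refine lintegral_mono fun y => ?_
        rw [lintegral_mul_const _ hm.of_uncurry_right]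
        exact mul_le_mul_left (hky y) _
    _ = _ := lintegral_const_mul' _ _ ENNReal.ofReal_ne_top

/-- The weak type estimate for the positive kernel `barK`. -/
lemma exists_gammaInv_lintegral_barK_le (hn : 1 ≤ n) :
    ∃ C : ℝ≥0, ∀ f : E n → ℝ≥0∞, Measurable f → ∀ s : ℝ, 0 < s →
      gammaInv n {x | ENNReal.ofReal s < ∫⁻ y, ENNReal.ofReal (barK x y) * f y} ≤
        C * (∫⁻ x, f x ∂(gammaInv n)) / ENNReal.ofReal s := by
  obtain ⟨K, hK, hker⟩ := exists_barK_le_angularKernel hn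
  obtain ⟨C, hC, hsph⟩ := exists_lintegral_angularKernel_le hn
  refine ⟨(2 * (K * C)).toNNReal, fun f hf s hs => ?_⟩
  have hs0 : ENNReal.ofReal s ≠ 0 := (ENNReal.ofReal_pos.2 hs).ne'
  set p := Real.pi ^ ((n : ℝ) / 2) with hp
  have hp0 : 0 < p := by positivity
  set g := fun y : E n => ENNReal.ofReal (Real.exp (‖y‖ ^ 2)) * f y with hg
  have hgm : Measurable g := by simp only [hg]; fun_prop
  have hfg : ∫⁻ x, f x ∂(gammaInv n) = ENNReal.ofReal p * ∫⁻ y, g y := by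
    rw [gammaInv, lintegral_withDensity_eq_lintegral_mul _
      measurable_density.ennreal_ofReal hf,
      ← lintegral_const_mul' _ _ ENNReal.ofReal_ne_top]
    refine lintegral_congr fun y => ?_
    simp only [Pi.mul_apply, density, hg]
    rw [ENNReal.ofReal_mul hp0.le, mul_assoc]
  have hkm : Measurable fun q : E n × E n => ENNReal.ofReal (K * angularKernel q.1 q.2) * g q.2 :=
    (measurable_angularKernel.const_mul K).ennreal_ofReal.mul (hgm.comp measurable_snd)
  set A := fun ω : E n => ∫⁻ y, ENNReal.ofReal (K * angularKernel ω y) * g y with hA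
  have hAm : Measurable A := hkm.lintegral_prod_right'
  set φ := fun r : ℝ => Real.exp (r ^ 2) * r ^ n / (1 + r ^ 2) with hφ
  set U := {x : E n | ENNReal.ofReal (φ ‖x‖) ≤ A (‖x‖⁻¹ • x) / ENNReal.ofReal s} with hU
  obtain ⟨hUm, hUle⟩ := setLIntegral_exp_sq_le hn (hAm.div_const (ENNReal.ofReal s)) hU
  have hsub : {x | ENNReal.ofReal s < ∫⁻ y, ENNReal.ofReal (barK x y) * f y} ⊆ U := by
    intro x hx
    rcases eq_or_ne x 0 with rfl | hx0
    -- The origin has no direction but belongs to U, since φ(0) = 0 for n ≥ 1.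
    · simp [hU, hφ, show n ≠ 0 by omega]
    · have hle : ENNReal.ofReal (φ ‖x‖) * ∫⁻ y, ENNReal.ofReal (barK x y) * f y ≤
          A (‖x‖⁻¹ • x) := by
        rw [← lintegral_const_mul' _ _ ENNReal.ofReal_ne_top]
        refine lintegral_mono fun y => ?_
        simp only [hg]
        rw [← mul_assoc, ← mul_assoc, ← ENNReal.ofReal_mul (by simp only [hφ]; positivity),
          ← ENNReal.ofReal_mul
            (mul_nonneg hK.le (angularKernel_nonneg (‖x‖⁻¹ • x) y)), mul_assoc K]
        gcongr ENNReal.ofReal ?_ * _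
        exact hker x y hx0
      change ENNReal.ofReal (φ ‖x‖) ≤ A (‖x‖⁻¹ • x) / ENNReal.ofReal s
      rw [ENNReal.le_div_iff_mul_le (Or.inl hs0) (Or.inl ENNReal.ofReal_ne_top)]
      exact (mul_le_mul_right hx.le _).trans hle
  have hsphere : ∫⁻ ω : Metric.sphere (0 : E n) 1, A (ω : E n)
      ∂(volume : Measure (E n)).toSphere ≤ ENNReal.ofReal (K * C) * ∫⁻ y, g y :=
    lintegral_sphere_angularKernel_le hK.le hsph hgm
  calc gammaInv n {x | ENNReal.ofReal s < ∫⁻ y, ENNReal.ofReal (barK x y) * f y}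
      ≤ gammaInv n U := measure_mono hsub
    _ = ENNReal.ofReal p * ∫⁻ x in U, ENNReal.ofReal (Real.exp (‖x‖ ^ 2)) := by
        rw [gammaInv, withDensity_apply _ hUm, ← lintegral_const_mul' _ _ ENNReal.ofReal_ne_top]
        refine lintegral_congr fun x => ?_
        rw [density, ENNReal.ofReal_mul hp0.le]
    _ ≤ ENNReal.ofReal p * (2 * ∫⁻ ω : Metric.sphere (0 : E n) 1, A (ω : E n) / ENNReal.ofReal s
          ∂(volume : Measure (E n)).toSphere) := mul_le_mul_right hUle _
    _ = ENNReal.ofReal p * (2 * ((∫⁻ ω : Metric.sphere (0 : E n) 1, A (ω : E n)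
          ∂(volume : Measure (E n)).toSphere) / ENNReal.ofReal s)) := by
        simp only [div_eq_mul_inv]
        rw [lintegral_mul_const' _ _ (ENNReal.inv_ne_top.2 hs0)]
    _ ≤ ENNReal.ofReal p * (2 * ((ENNReal.ofReal (K * C) * ∫⁻ y, g y) / ENNReal.ofReal s)) := by
        gcongr
    _ = _ := by
        rw [hfg]
        change _ = ENNReal.ofReal (2 * (K * C)) * _ / _
        rw [ENNReal.ofReal_mul (by norm_num : (0 : ℝ) ≤ 2), ENNReal.ofReal_ofNat]
        simp only [div_eq_mul_inv]
        ring

/-! ### Absolute convergence and transfer to dominated operators. -/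

lemma density_pos (x : E n) : 0 < density x := by unfold density; positivity

lemma volume_absolutelyContinuous_gammaInv : (volume : Measure (E n)) ≪ gammaInv n :=
  withDensity_absolutelyContinuous' measurable_density.ennreal_ofReal.aemeasurable
    (Filter.Eventually.of_forall fun x => (ENNReal.ofReal_pos.2 (density_pos x)).ne')

lemma integrable_density_smul {f : E n → ℂ} (hf : Integrable f (gammaInv n)) :
    Integrable fun x => density x • f x := by
  have h := (integrable_withDensity_iff_integrable_smul' measurable_density.ennreal_ofReal
    (Filter.Eventually.of_forall fun x => ENNReal.ofReal_lt_top)).1 hf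
  simpa only [ENNReal.toReal_ofReal (density_pos _).le] using h

lemma integrable_barK_mul_norm (hn : 1 ≤ n) {f : E n → ℂ} (hf : Integrable f (gammaInv n))
    (x : E n) : Integrable fun y => barK x y * ‖f y‖ := by
  obtain ⟨B, hB, h⟩ := exists_barK_le_exp hn x
  have hfm : AEStronglyMeasurable f volume :=
    hf.aestronglyMeasurable.mono_ac volume_absolutelyContinuous_gammaInv
  have hk : Measurable fun y => barK x y := (measurable_barK hn).of_uncurry_left
  have hp : 0 < Real.pi ^ ((n : ℝ) / 2) := by positivity
  refine ((integrable_density_smul hf).norm.const_mul (B / Real.pi ^ ((n : ℝ) / 2))).mono'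
    (hk.aestronglyMeasurable.mul hfm.norm) (Filter.Eventually.of_forall fun y => ?_)
  rw [Real.norm_of_nonneg (mul_nonneg (barK_nonneg hn x y) (norm_nonneg _)), norm_smul,
    Real.norm_of_nonneg (density_pos y).le, ← mul_assoc]
  gcongr
  calc barK x y ≤ B * Real.exp (‖y‖ ^ 2) := h y
    _ = _ := by unfold density; field_simp

/-- A pointwise kernel bound by `barK` gives absolute convergence. -/
lemma integrable_mul_of_le_barK (hn : 1 ≤ n) {f : E n → ℂ} (hf : Integrable f (gammaInv n))
    {x : E n} {k : E n → ℝ} (hk : Measurable k) {C : ℝ} (hkC : ∀ y, |k y| ≤ C * barK x y) :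
    Integrable fun y => (k y : ℂ) * f y := by
  have hfm : AEStronglyMeasurable f volume :=
    hf.aestronglyMeasurable.mono_ac volume_absolutelyContinuous_gammaInv
  refine ((integrable_barK_mul_norm hn hf x).const_mul C).mono'
    ((Complex.measurable_ofReal.comp hk).aestronglyMeasurable.mul hfm)
    (Filter.Eventually.of_forall fun y => ?_)
  rw [norm_mul, Complex.norm_real, Real.norm_eq_abs, ← mul_assoc]
  exact mul_le_mul_of_nonneg_right (hkC y) (norm_nonneg _)

lemma enorm_integral_le_of_le_barK {f : E n → ℂ} {x : E n} {k : E n → ℝ} {C : ℝ} (hC : 0 ≤ C)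
    (hkC : ∀ y, |k y| ≤ C * barK x y) :
    ‖∫ y, (k y : ℂ) * f y‖ₑ ≤ ENNReal.ofReal C * ∫⁻ y, ENNReal.ofReal (barK x y) * ‖f y‖ₑ := by
  refine (enorm_integral_le_lintegral_enorm _).trans ?_
  rw [← lintegral_const_mul' _ _ ENNReal.ofReal_ne_top]
  refine lintegral_mono fun y => ?_
  rw [enorm_mul, ← mul_assoc, ← ENNReal.ofReal_mul hC, ← ofReal_norm (k y : ℂ),
    Complex.norm_real, Real.norm_eq_abs]
  gcongr
  exact hkC y

lemma aemeasurable_enorm_integral {f : E n → ℂ} (hf : Integrable f (gammaInv n))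
    {k : E n → E n → ℝ} (hk : Measurable (Function.uncurry k)) :
    AEMeasurable (fun x => ‖∫ y, (k x y : ℂ) * f y‖ₑ) (gammaInv n) := by
  have hfm : AEStronglyMeasurable f volume :=
    hf.aestronglyMeasurable.mono_ac volume_absolutelyContinuous_gammaInv
  have heq : ∀ x, ∫ y, (k x y : ℂ) * f y = ∫ y, (k x y : ℂ) * hfm.mk f y := fun x => by
    refine integral_congr_ae ?_
    filter_upwards [hfm.ae_eq_mk] with y hy
    rw [hy]
  simp only [heq]
  have hu : StronglyMeasurable (Function.uncurry fun x y : E n => (k x y : ℂ) * hfm.mk f y) :=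
    ((Complex.measurable_ofReal.comp hk).mul
      (hfm.stronglyMeasurable_mk.measurable.comp measurable_snd)).stronglyMeasurable
  exact hu.integral_prod_right.measurable.enorm.aemeasurable

/-- Operators pointwise dominated by the positive operator with kernel `barK` are of weak type. -/
lemma exists_weakType_of_le (hn : 1 ≤ n) {C₀ : ℝ} (hC₀ : 0 < C₀) :
    ∃ C : ℝ≥0, ∀ T : (E n → ℂ) → E n → ℝ≥0∞,
      (∀ f, Integrable f (gammaInv n) → AEMeasurable (T f) (gammaInv n)) →
      (∀ f, Integrable f (gammaInv n) → ∀ x,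
        T f x ≤ ENNReal.ofReal C₀ * ∫⁻ y, ENNReal.ofReal (barK x y) * ‖f y‖ₑ) →
      WeakType11With T C := by
  obtain ⟨C, hC⟩ := exists_gammaInv_lintegral_barK_le hn
  refine ⟨C * C₀.toNNReal, fun T hTm hT f hf => ⟨hTm f hf, fun s hs => ?_⟩⟩
  have hae := hf.aestronglyMeasurable.ae_eq_mk
  -- The positive estimate requires a measurable function. Passing to a representative changes no
  -- Lebesgue integral, because Lebesgue null sets include the γ₋₁ null sets.
  set f' := hf.aestronglyMeasurable.mk f with hf'
  have hvol : f =ᵐ[volume] f' := volume_absolutelyContinuous_gammaInv.ae_eq hae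
  have hm : Measurable fun y => ‖f' y‖ₑ :=
    hf.aestronglyMeasurable.stronglyMeasurable_mk.measurable.enorm
  have hC₀' : ENNReal.ofReal C₀ ≠ 0 := (ENNReal.ofReal_pos.2 hC₀).ne'
  have hsub : {x | ENNReal.ofReal s < T f x} ⊆
      {x | ENNReal.ofReal (s / C₀) < ∫⁻ y, ENNReal.ofReal (barK x y) * ‖f' y‖ₑ} := by
    intro x hx
    have h1 := lt_of_lt_of_le hx (hT f hf x)
    have h2 : ∫⁻ y, ENNReal.ofReal (barK x y) * ‖f y‖ₑ =
        ∫⁻ y, ENNReal.ofReal (barK x y) * ‖f' y‖ₑ := by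
      refine lintegral_congr_ae ?_
      filter_upwards [hvol] with y hy
      rw [hy]
    rw [h2] at h1
    change ENNReal.ofReal (s / C₀) < _
    rw [ENNReal.ofReal_div_of_pos hC₀]
    exact ENNReal.div_lt_of_lt_mul' h1
  have hnorm : ∫⁻ x, ‖f x‖ₑ ∂(gammaInv n) = ∫⁻ x, ‖f' x‖ₑ ∂(gammaInv n) := by
    refine lintegral_congr_ae ?_
    filter_upwards [hae] with y hy
    rw [hy]
  refine (measure_mono hsub).trans ((hC _ hm _ (by positivity)).trans (le_of_eq ?_))
  rw [hnorm, ENNReal.ofReal_div_of_pos hC₀, ENNReal.coe_mul]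
  change _ = C * ENNReal.ofReal C₀ * _ / _
  rw [div_eq_mul_inv, ENNReal.inv_div (Or.inl ENNReal.ofReal_ne_top) (Or.inl hC₀'),
    div_eq_mul_inv, div_eq_mul_inv]
  ring

/-! ### Global part of the maximal operator. -/

lemma measurable_mehlerKernel (t : ℝ) :
    Measurable fun p : E n × E n => mehlerKernel t p.1 p.2 := by
  unfold mehlerKernel mehlerKernelGamma density; fun_prop

lemma continuousOn_mehlerKernel (x y : E n) :
    ContinuousOn (fun t : ℝ => mehlerKernel t x y) (Set.Ioi 0) := by
  have h1 : ∀ t ∈ Set.Ioi (0 : ℝ), 0 < 1 - Real.exp (-(2 * t)) := fun t ht => by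
    have h : (0 : ℝ) < t := ht
    rw [sub_pos, Real.exp_lt_one_iff]; linarith
  have h2 : ∀ t ∈ Set.Ioi (0 : ℝ), 0 < 1 - Real.exp (-t) := fun t ht => by
    have h : (0 : ℝ) < t := ht
    rw [sub_pos, Real.exp_lt_one_iff]; linarith
  unfold mehlerKernel mehlerKernelGamma
  refine ContinuousOn.mul (ContinuousOn.mul (ContinuousOn.div (by fun_prop)
    (ContinuousOn.mul (by fun_prop) (ContinuousOn.rpow_const (by fun_prop)
      fun t ht => Or.inl (h1 t ht).ne')) fun t ht => ?_)
    (Real.continuous_exp.comp_continuousOn (ContinuousOn.sub (ContinuousOn.neg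
      (ContinuousOn.div (by fun_prop) (by fun_prop) fun t _ => by positivity))
      (ContinuousOn.div (by fun_prop) (by fun_prop) fun t ht => ?_)))) (by fun_prop)
  · have := h1 t ht
    positivity
  · have := h2 t ht
    positivity

lemma IsCutoff.mem_Icc {χ : E n × E n → ℝ} (hχ : IsCutoff χ) (p : E n × E n) :
    χ p ∈ Set.Icc 0 1 :=
  ⟨(Set.indicator_nonneg (fun _ _ => zero_le_one) p).trans (hχ.ge p),
    (hχ.le p).trans (Set.indicator_le_self' (fun _ _ => zero_le_one) p)⟩

lemma IsCutoff.eq_one {χ : E n × E n → ℝ} (hχ : IsCutoff χ) {p : E n × E n}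
    (hp : p ∈ localRegion n 1) : χ p = 1 := by
  refine le_antisymm (hχ.mem_Icc p).2 ?_
  have := hχ.ge p
  rwa [Set.indicator_of_mem hp] at this

lemma measurable_mehlerKernelGlob {χ : E n × E n → ℝ} (hχ : IsCutoff χ) (t : ℝ) :
    Measurable (Function.uncurry fun x y : E n => mehlerKernelGlob χ t x y) :=
  (measurable_mehlerKernel t).sub (hχ.measurable.mul (measurable_mehlerKernel t))

/-- The factor 1 - χ vanishes on N₁ and lies in [0, 1] on the global region, so the constant is
independent of both χ and t. -/
lemma exists_mehlerKernelGlob_le_barK (hn : 1 ≤ n) :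
    ∃ C : ℝ, 0 < C ∧ ∀ χ : E n × E n → ℝ, IsCutoff χ → ∀ t : ℝ, 0 < t → ∀ x y : E n,
      |mehlerKernelGlob χ t x y| ≤ C * barK x y := by
  obtain ⟨C, hC, h⟩ := exists_mehlerKernel_le_barK hn
  refine ⟨C, hC, fun χ hχ t ht x y => ?_⟩
  have hfac : mehlerKernelGlob χ t x y = (1 - χ (x, y)) * mehlerKernel t x y := by
    unfold mehlerKernelGlob; ring
  by_cases hp : (x, y) ∈ localRegion n 1
  · rw [hfac, hχ.eq_one hp, sub_self, zero_mul, abs_zero]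
    exact mul_nonneg hC.le (barK_nonneg hn x y)
  · have h0 := mehlerKernel_nonneg ht x y
    have h1 := hχ.mem_Icc (x, y)
    rw [hfac, abs_of_nonneg (mul_nonneg (sub_nonneg.2 h1.2) h0)]
    calc (1 - χ (x, y)) * mehlerKernel t x y ≤ 1 * mehlerKernel t x y := by
          gcongr; linarith [h1.1]
      _ ≤ C * barK x y := by rw [one_mul]; exact h t ht x y hp

/-- Makes the supremum over t countable, hence measurable: if g exceeded the rational supremum
somewhere, it would do so on an open set, which contains a rational. -/
lemma iSup_pos_eq_iSup_rat {g : ℝ → ℝ≥0∞} (hg : ContinuousOn g (Set.Ioi 0)) :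
    ⨆ (t : ℝ) (_ : 0 < t), g t = ⨆ (q : ℚ) (_ : 0 < q), g q := by
  apply le_antisymm
  · refine iSup₂_le fun t ht => ?_
    by_contra! hlt
    obtain ⟨V, hV, hVeq⟩ := (continuousOn_iff'.1 hg) _
      (isOpen_Ioi (a := ⨆ (q : ℚ) (_ : 0 < q), g q))
    have hopen : IsOpen (V ∩ Set.Ioi 0) := hV.inter isOpen_Ioi
    have hne : (V ∩ Set.Ioi (0 : ℝ)).Nonempty := ⟨t, by rw [← hVeq]; exact ⟨hlt, ht⟩⟩
    obtain ⟨q, hq⟩ := Rat.denseRange_cast.exists_mem_open hopen hne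
    have hq0 : (0 : ℝ) < q := hq.2
    rw [← hVeq] at hq
    have hq1 : (⨆ (q : ℚ) (_ : 0 < q), g q) < g q := hq.1
    exact absurd (le_iSup₂ (f := fun (q : ℚ) (_ : 0 < q) => g q) q (by exact_mod_cast hq0))
      (not_le.2 hq1)
  · exact iSup₂_le fun q hq => le_iSup₂ (f := fun (t : ℝ) (_ : 0 < t) => g t) (q : ℝ)
      (by exact_mod_cast hq)

lemma aemeasurable_maximalGlob (hn : 1 ≤ n) {χ : E n × E n → ℝ} (hχ : IsCutoff χ) {f : E n → ℂ}
    (hf : Integrable f (gammaInv n)) : AEMeasurable (maximalGlob χ f) (gammaInv n) := by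
  obtain ⟨C, hC, h⟩ := exists_mehlerKernelGlob_le_barK hn
  -- Dominated convergence, with the t-independent majorant C K̄(x, ·)|f|, integrable for every x.
  have hcont : ∀ x, ContinuousOn (fun t => ‖mehlerGlob χ t f x‖ₑ) (Set.Ioi 0) := by
    intro x
    refine continuous_enorm.comp_continuousOn ?_
    unfold mehlerGlob
    refine continuousOn_of_dominated (bound := fun y => C * (barK x y * ‖f y‖))
      (fun t ht => ?_) (fun t ht => Filter.Eventually.of_forall fun y => ?_)
      ((integrable_barK_mul_norm hn hf x).const_mul C)
      (Filter.Eventually.of_forall fun y => ?_)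
    · exact (integrable_mul_of_le_barK hn hf
        (measurable_mehlerKernelGlob hχ t).of_uncurry_left
        (h χ hχ t ht x)).aestronglyMeasurable
    · rw [norm_mul, Complex.norm_real, Real.norm_eq_abs, ← mul_assoc]
      exact mul_le_mul_of_nonneg_right (h χ hχ t ht x y) (norm_nonneg _)
    · refine ContinuousOn.mul (Complex.continuous_ofReal.comp_continuousOn ?_) continuousOn_const
      unfold mehlerKernelGlob
      exact (continuousOn_mehlerKernel x y).sub
        (continuousOn_const.mul (continuousOn_mehlerKernel x y))
  have heq : maximalGlob χ f =
      fun x => ⨆ (q : ℚ) (_ : 0 < q), ‖mehlerGlob χ (q : ℝ) f x‖ₑ := by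
    ext x
    exact iSup_pos_eq_iSup_rat (hcont x)
  rw [heq]
  refine AEMeasurable.iSup fun q => AEMeasurable.iSup fun _ => ?_
  exact aemeasurable_enorm_integral hf (measurable_mehlerKernelGlob hχ q)

end InverseGauss

/-- (1) `H^* ≤ C K̄` on the global region; (2) the operator with kernel `K̄` is given by an
absolutely convergent integral on `L¹(γ₋₁)` and is of weak type `(1,1)`; (3) the same holds for the
global parts of the semigroup operators, and the global part of the Mehler maximal operator is of
weak type `(1,1)`. The constants depend on `n` only. -/
theorem proposition4p5 (n : ℕ) (hn : 1 ≤ n) :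
    (∃ C : ℝ, 0 < C ∧ ∀ x y : InverseGauss.E n, (x, y) ∈ InverseGauss.globalRegion n →
      InverseGauss.maximalMehlerKernel x y ≤ ENNReal.ofReal (C * InverseGauss.barK x y)) ∧
    ((∀ f : InverseGauss.E n → ℂ, Integrable f (InverseGauss.gammaInv n) →
        ∀ x : InverseGauss.E n,
          Integrable (fun y => (InverseGauss.barK x y : ℂ) * f y) volume) ∧
      ∃ C : ℝ≥0, InverseGauss.WeakType11With
        (fun (f : InverseGauss.E n → ℂ) x => ‖InverseGauss.barKOp f x‖ₑ) C) ∧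
    ((∀ χ : InverseGauss.E n × InverseGauss.E n → ℝ, InverseGauss.IsCutoff χ →
        ∀ f : InverseGauss.E n → ℂ, Integrable f (InverseGauss.gammaInv n) →
          ∀ t : ℝ, 0 < t → ∀ x : InverseGauss.E n,
            Integrable (fun y => (InverseGauss.mehlerKernelGlob χ t x y : ℂ) * f y) volume) ∧
      ∃ C : ℝ≥0, ∀ χ : InverseGauss.E n × InverseGauss.E n → ℝ, InverseGauss.IsCutoff χ →
        InverseGauss.WeakType11With (InverseGauss.maximalGlob χ) C) := by
  open InverseGauss in
  refine ⟨?_, ⟨?_, ?_⟩, ?_, ?_⟩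
  · obtain ⟨C, hC, h⟩ := exists_mehlerKernel_le_barK hn
    exact ⟨C, hC, fun x y hxy => iSup₂_le fun t ht =>
      ENNReal.ofReal_le_ofReal (h t ht x y hxy)⟩
  · exact fun f hf x => integrable_mul_of_le_barK hn hf (C := 1)
      (measurable_barK hn).of_uncurry_left
      fun y => by rw [abs_of_nonneg (barK_nonneg hn x y), one_mul]
  · obtain ⟨C, hC⟩ := exists_weakType_of_le hn one_pos
    exact ⟨C, hC _ (fun f hf => aemeasurable_enorm_integral hf (measurable_barK hn))
      fun f hf x => enorm_integral_le_of_le_barK zero_le_one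
        fun y => by rw [abs_of_nonneg (barK_nonneg hn x y), one_mul]⟩
  · obtain ⟨C, -, h⟩ := exists_mehlerKernelGlob_le_barK hn
    exact fun χ hχ f hf t ht x => integrable_mul_of_le_barK hn hf
      (measurable_mehlerKernelGlob hχ t).of_uncurry_left (h χ hχ t ht x)
  · obtain ⟨C₀, hC₀, h⟩ := exists_mehlerKernelGlob_le_barK hn
    obtain ⟨C, hC⟩ := exists_weakType_of_le hn hC₀
    exact ⟨C, fun χ hχ => hC _ (fun f hf => aemeasurable_maximalGlob hn hχ hf)
      fun f hf x => iSup₂_le fun t ht => enorm_integral_le_of_le_barK hC₀.le (h χ hχ t ht x)⟩
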